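/- For $k\ge 1$ let $[k]=\{1,\dots,k\}$ and $\Delta_k=\{x\in[0,1]^k:\sum_{i=1}^k x_i=1\}$, with extreme points $e^1,\dots,e^k$, and for $n\ge 1$ let $\Delta_{k,n}=\Delta_k\cap\left(\tfrac1n\mathbb{Z}\right)^k$. A cut is a function $P:\Delta_k\to[k+1]$ with $P(e^i)=i$ for all $i\in[k]$; it is non-opposite if $P(x)\in\{i\in[k]:x_i\neq 0\}\cup\{k+1\}$ for every $x\in\Delta_k$. For a probability distribution $\mathcal{P}$ over cuts (on the $\sigma$-algebra generated by the evaluations $P\mapsto P(x)$) let $$\tau_{k,n}(\mathcal{P})=\max_{x,y\in\Delta_{k,n},\,x\ne y}\frac{\Pr_{P\sim\mathcal{P}}(P(x)\ne P(y))}{\tfrac12\|x-y\|_1},\qquad \tilde\tau^*_{k,n}=\min\{\tau_{k,n}(\mathcal{P}):\mathcal{P}\text{ is a probability distribution over non-opposite cuts}\}.$$ Theorem. There is an absolute constant $C$ such that for every integer $n\ge 1$ the minimum defining $\tilde\tau^*_{4,n}$ is attained and $$\tilde\tau^*_{4,n}\ \ge\ 1.20016-\frac{C}{n}.$$ -/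

import Mathlib

open MeasureTheory

noncomputable section

/-- The simplex `Δ_k = {x ∈ [0,1]^k : ∑ x_i = 1}`. -/
abbrev Simplex (k : ℕ) : Type := stdSimplex ℝ (Fin k)

/-- Half of the `ℓ₁` distance of two points of the simplex. -/
def halfL1Dist {k : ℕ} (x y : Simplex k) : ℝ :=
  (1 / 2) * ∑ i, |x.1 i - y.1 i|

/-- The discretized simplex `Δ_{k,n} = Δ_k ∩ ((1/n) ℤ)^k`. -/
def discreteSimplex (k n : ℕ) : Set (Simplex k) :=
  {x | ∀ i, ∃ z : ℤ, x.1 i = (1 / (n : ℝ)) * (z : ℝ)}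

/-- A function `P : Δ_k → [k+1]` is a cut if `P(e^i) = i` for every `i ∈ [k]`. The label `i ∈ [k]`
is `i.castSucc`, and the additional label `k+1` is `Fin.last k`. -/
def IsCut {k : ℕ} (P : Simplex k → Fin (k + 1)) : Prop :=
  ∀ (x : Simplex k) (i : Fin k), x.1 = Pi.single i 1 → P x = i.castSucc

/-- The type of cuts. As a subtype of a product of finite discrete spaces it carries the
σ-algebra generated by the evaluations `P ↦ P x`. -/
abbrev Cut (k : ℕ) : Type := {P : Simplex k → Fin (k + 1) // IsCut P}

/-- A cut is non-opposite if `P(x) ∈ Support(x) ∪ {k+1}` for every `x ∈ Δ_k`. -/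
def IsNonOpposite {k : ℕ} (P : Cut k) : Prop :=
  ∀ x : Simplex k, (∃ i : Fin k, x.1 i ≠ 0 ∧ P.1 x = i.castSucc) ∨ P.1 x = Fin.last k

/-- The type of non-opposite cuts, with the σ-algebra generated by the evaluations. -/
abbrev NonOppositeCut (k : ℕ) : Type := {P : Cut k // IsNonOpposite P}

/-- The maximum density of a distribution `μ` over cuts on `Δ_{k,n}`: the maximum, over the pairs
of distinct points of `Δ_{k,n}`, of `Pr(P(x) ≠ P(y)) / ((1/2) ‖x - y‖₁)`. For `k ≥ 2` and `n ≥ 1`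
this is the supremum of a finite nonempty set of reals, hence a maximum. -/
def maxDensity (k n : ℕ) (μ : Measure (Cut k)) : ℝ :=
  sSup {d : ℝ | ∃ x ∈ discreteSimplex k n, ∃ y ∈ discreteSimplex k n, x ≠ y ∧
    d = μ.real {P | P.1 x ≠ P.1 y} / halfL1Dist x y}

/-- The maximum densities on `Δ_{k,n}` of all distributions over non-opposite cuts. A distribution
over non-opposite cuts is regarded as a distribution over cuts by push-forward along the
inclusion. -/
def nonOppositeDensities (k n : ℕ) : Set ℝ :=
  {t : ℝ | ∃ ν : Measure (NonOppositeCut k), IsProbabilityMeasure ν ∧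
    t = maxDensity k n (ν.map Subtype.val)}

/-- The minimum of the maximum density on `Δ_{k,n}` over all distributions over non-opposite
cuts. -/
def minMaxDensity (k n : ℕ) : ℝ := sInf (nonOppositeDensities k n)

end

/-! Write `τ` for the maximum density of a random non-opposite cut. Grid points that differ by
moving one unit have half-distance `1/n`, so they are separated with probability at most `κ = τ/n`.
The expected number of label changes along any family of lattice paths is thus at most its total
length times `κ`. Any lower bound on a weighted count of changes that holds for every single cut
therefore bounds `τ` from below.

Two such counts are combined. On a triangular face, in each of three directions, rows in the outer
third are prolonged along the sides to two vertices, and rows in the middle third are taken as they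
are. Every labelling has at least `2n - O(1)` changes (`le_faceCost`), while the total length is
about `5/3 n^2`. This alone gives `6/5`. Inside the tetrahedron a Sperner-type shift shows that at
least about `n^2/2` small simplices are not monochromatic, up to the number of points of a chosen
face with the fifth label (`card_monochromatic_le`). Each has at least three cut edges, so if no
such points existed this count alone would give `3/2`.

The gain over `6/5` comes from playing the two against each other. Many points of the fifth label on
a face force excess face cost, or additional changes along the sides of the face (`faceBound`), or,
if they lie near a vertex, changes along paths from that vertex (`card_innerOthers_zero_le`). Adding
these inequalities with suitable weights eliminates the number of such points (`tetraCost_ge`). The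
ratio of the leading terms is `(279/8)/(523/18) > 1.20028`, which leaves room for the lower-order
terms.

The minimum is attained because only the restriction of a cut to the finite grid matters. The laws
of this restriction form a compact simplex, on which the density is lower semicontinuous. -/

/-! ### Label changes along a sequence. -/

section Changes

variable {Λ : Type*} [DecidableEq Λ]

/-- The number of label changes along the first `N` steps of a sequence of labels. -/
def changes (p : ℕ → Λ) (N : ℕ) : ℕ := ((Finset.range N).filter fun i => p i ≠ p (i + 1)).card

theorem changes_succ (p : ℕ → Λ) (N : ℕ) :
    changes p (N + 1) = changes p N + if p N ≠ p (N + 1) then 1 else 0 := by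
  unfold changes
  rw [Finset.range_add_one, Finset.filter_insert]
  split_ifs with h
  · rw [Finset.card_insert_of_notMem (by simp)]
  · rfl

theorem changes_eq_sum (p : ℕ → Λ) (N : ℕ) :
    changes p N = ∑ i ∈ Finset.range N, if p i ≠ p (i + 1) then 1 else 0 := by
  simp [changes, Finset.card_filter]

theorem eq_of_changes_eq_zero {p : ℕ → Λ} {N : ℕ} (h : changes p N = 0) :
    ∀ i ≤ N, p i = p 0 := by
  intro i
  induction i with
  | zero => intro _; rfl
  | succ i ih =>
    intro hi
    rw [← ih (by omega)]
    unfold changes at h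
    rw [Finset.card_eq_zero, Finset.filter_eq_empty_iff] at h
    have := h (Finset.mem_range.2 (show i < N by omega))
    push Not at this
    exact this.symm

theorem one_le_changes {p : ℕ → Λ} {N i j : ℕ} (hi : i ≤ N) (hj : j ≤ N) (h : p i ≠ p j) :
    1 ≤ changes p N := by
  by_contra hc
  have h0 : changes p N = 0 := by omega
  exact h ((eq_of_changes_eq_zero h0 i hi).trans (eq_of_changes_eq_zero h0 j hj).symm)

theorem card_image_le_changes (p : ℕ → Λ) (N : ℕ) :
    ((Finset.range (N + 1)).image p).card ≤ changes p N + 1 := by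
  induction N with
  | zero => simp [changes]
  | succ N ih =>
    rw [Finset.range_add_one, Finset.image_insert, changes_succ]
    split_ifs with h
    · exact (Finset.card_insert_le _ _).trans (by omega)
    · push Not at h
      rw [Finset.insert_eq_of_mem]
      · simpa using ih
      · rw [← h]
        exact Finset.mem_image_of_mem p (by simp)

/-- A sequence with at most one change is constant up to some index, and constant after it. -/
theorem exists_threshold {p : ℕ → Λ} {N : ℕ} (h : changes p N ≤ 1) (hne : p 0 ≠ p N) :
    ∃ τ < N, (∀ i ≤ τ, p i = p 0) ∧ ∀ i, τ < i → i ≤ N → p i = p N := by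
  induction N with
  | zero => exact absurd rfl hne
  | succ N ih =>
    rw [changes_succ] at h
    by_cases hN : p N = p (N + 1)
    · rw [if_neg (by simpa using hN)] at h
      obtain ⟨τ, hτ, h1, h2⟩ := ih (by omega) (by rwa [hN])
      refine ⟨τ, by omega, h1, fun i hi hi' => ?_⟩
      rcases Nat.lt_or_ge N i with h3 | h3
      · rw [show i = N + 1 by omega]
      · rw [h2 i hi h3, hN]
    · rw [if_pos (by simpa using hN)] at h
      refine ⟨N, by omega, eq_of_changes_eq_zero (by omega), fun i hi hi' => ?_⟩
      rw [show i = N + 1 by omega]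

end Changes

/-! ### Labelled triangles, their rows, and clean rows. -/

section Face

variable {Λ : Type*}

/-- A labelling `g a b d` of the grid points `a + b + d = n` of a triangle whose vertices are
labelled `l₁`, `l₂`, `l₃`, where no vertex label occurs on the opposite side. -/
structure FaceLabeling (n : ℕ) (l₁ l₂ l₃ : Λ) (g : ℕ → ℕ → ℕ → Λ) : Prop where
  ne12 : l₁ ≠ l₂
  ne13 : l₁ ≠ l₃
  ne23 : l₂ ≠ l₃
  v1 : g n 0 0 = l₁
  v2 : g 0 n 0 = l₂
  v3 : g 0 0 n = l₃
  s1 : ∀ b d, b + d = n → g 0 b d ≠ l₁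
  s2 : ∀ a d, a + d = n → g a 0 d ≠ l₂
  s3 : ∀ a b, a + b = n → g a b 0 ≠ l₃

/-- Rotation of the coordinates of a triangle. -/
def rot (g : ℕ → ℕ → ℕ → Λ) (x y z : ℕ) : Λ := g z x y

theorem FaceLabeling.rot {n : ℕ} {l₁ l₂ l₃ : Λ} {g : ℕ → ℕ → ℕ → Λ}
    (h : FaceLabeling n l₁ l₂ l₃ g) : FaceLabeling n l₂ l₃ l₁ (rot g) where
  ne12 := h.ne23
  ne13 := h.ne12.symm
  ne23 := h.ne13.symm
  v1 := h.v2
  v2 := h.v3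
  v3 := h.v1
  s1 := fun b d e => h.s2 d b (by omega)
  s2 := fun a d e => h.s3 d a (by omega)
  s3 := fun a b e => h.s1 a b (by omega)

/-- The row of points with first coordinate `t`. -/
def row (g : ℕ → ℕ → ℕ → Λ) (n t i : ℕ) : Λ := g t (n - t - i) i

/-- The row of points with first coordinate `j`, extended at both ends along the sides of the
triangle to the second and to the third vertex. -/
def extRow (g : ℕ → ℕ → ℕ → Λ) (n j i : ℕ) : Λ := g (min i j - (i - n)) (n - i) (i - j)

/-- The label `l` occurs in the row with first coordinate `t`. -/
def RowHas (n : ℕ) (g : ℕ → ℕ → ℕ → Λ) (l : Λ) (t : ℕ) : Prop :=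
  ∃ y z, t + y + z = n ∧ g t y z = l

/-- A label other than the three vertex labels occurs in the row with first coordinate `t`. -/
def RowHasOther (n : ℕ) (l₁ l₂ l₃ : Λ) (g : ℕ → ℕ → ℕ → Λ) (t : ℕ) : Prop :=
  ∃ y z, t + y + z = n ∧ g t y z ≠ l₁ ∧ g t y z ≠ l₂ ∧ g t y z ≠ l₃

variable {n c : ℕ} {l₁ l₂ l₃ : Λ} {g : ℕ → ℕ → ℕ → Λ}

open Classical in
/-- The number of rows in the middle third that contain the label `l`. -/
noncomputable def rowsWith (n c : ℕ) (g : ℕ → ℕ → ℕ → Λ) (l : Λ) : ℕ :=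
  ((Finset.Ioc c (2 * c)).filter (RowHas n g l)).card

open Classical in
/-- The number of rows in the middle third that contain a label other than the vertex labels. -/
noncomputable def rowsWithOther (n c : ℕ) (l₁ l₂ l₃ : Λ) (g : ℕ → ℕ → ℕ → Λ) : ℕ :=
  ((Finset.Ioc c (2 * c)).filter (RowHasOther n l₁ l₂ l₃ g)).card

theorem extRow_zero (h : FaceLabeling n l₁ l₂ l₃ g) (j : ℕ) : extRow g n j 0 = l₂ := by
  simp [extRow, h.v2]

theorem extRow_last (h : FaceLabeling n l₁ l₂ l₃ g) {j : ℕ} (hj : j ≤ n) :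
    extRow g n j (n + j) = l₃ := by
  have : extRow g n j (n + j) = g 0 0 n := by
    unfold extRow; congr 1 <;> omega
  rw [this, h.v3]

theorem row_eq_of {t y z : ℕ} (e : t + y + z = n) : row g n t z = g t y z := by
  unfold row; congr 1; omega

theorem card_Ioc_inter_ge {c : ℕ} {P : ℕ → Prop} [DecidablePred P] {m : ℕ}
    (hP : ∀ t, c < t → t ≤ 2 * c → t ≤ m → P t) :
    min c (m - c) ≤ ((Finset.Ioc c (2 * c)).filter P).card := by
  calc min c (m - c) = (Finset.Ioc c (min (2 * c) m)).card := by rw [Nat.card_Ioc]; omega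
    _ ≤ _ := Finset.card_le_card fun t ht => by
      rw [Finset.mem_Ioc] at ht
      rw [Finset.mem_filter, Finset.mem_Ioc]
      exact ⟨by omega, hP t (by omega) (by omega) (by omega)⟩

theorem card_Ioc_inter_ge' {c : ℕ} {P : ℕ → Prop} [DecidablePred P] {m : ℕ}
    (hP : ∀ t, c < t → t ≤ 2 * c → m < t → P t) :
    c ≤ ((Finset.Ioc c (2 * c)).filter P).card + (m - c) := by
  have : 2 * c - max c m ≤ ((Finset.Ioc c (2 * c)).filter P).card :=
    calc 2 * c - max c m = (Finset.Ioc (max c m) (2 * c)).card := by rw [Nat.card_Ioc]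
    _ ≤ _ := Finset.card_le_card fun t ht => by
      rw [Finset.mem_Ioc] at ht
      rw [Finset.mem_filter, Finset.mem_Ioc]
      exact ⟨by omega, hP t (by omega) (by omega) (by omega)⟩
  omega

/-- What a clean row with threshold `τ` says about the rows in the two other directions. -/
theorem rowsWith_of_clean {j τ : ℕ} (hc : 3 * c ≤ n) (hj : j ≤ c) (hτ : τ < n)
    (key : ∀ y z, j + y + z = n → (z + j ≤ τ → g j y z = l₂) ∧ (τ < z + j → g j y z = l₃)) :
    min c (n - τ - 1 - c) ≤ rowsWith n c (rot g) l₃ ∧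
    c ≤ rowsWith n c (rot g) l₂ + (n - τ - 1 - c) ∧
    min c (τ - j - c) ≤ rowsWith n c (rot (rot g)) l₂ ∧
    c ≤ rowsWith n c (rot (rot g)) l₃ + (τ - j - c) := by
  classical
  refine ⟨card_Ioc_inter_ge fun t h1 h2 h3 => ?_, card_Ioc_inter_ge' fun t h1 h2 h3 => ?_,
    card_Ioc_inter_ge fun t h1 h2 h3 => ?_, card_Ioc_inter_ge' fun t h1 h2 h3 => ?_⟩
  · exact ⟨n - j - t, j, by omega, (key t (n - j - t) (by omega)).2 (by omega)⟩
  · exact ⟨n - j - t, j, by omega, (key t (n - j - t) (by omega)).1 (by omega)⟩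
  · exact ⟨j, n - j - t, by omega, (key (n - j - t) t (by omega)).1 (by omega)⟩
  · exact ⟨j, n - j - t, by omega, (key (n - j - t) t (by omega)).2 (by omega)⟩

/-- Clean rows in two different directions meet in a point with the common label. -/
theorem threshold_lt_of_clean (h : FaceLabeling n l₁ l₂ l₃ g) {j k τ σ : ℕ} (hc : j + k ≤ n)
    (key : ∀ y z, j + y + z = n → (z + j ≤ τ → g j y z = l₂) ∧ (τ < z + j → g j y z = l₃))
    (key' : ∀ y z, k + y + z = n →
      (z + k ≤ σ → rot g k y z = l₃) ∧ (σ < z + k → rot g k y z = l₁)) :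
    τ < n - k ∧ j + k ≤ σ := by
  have a := key k (n - j - k) (by omega)
  have b := key' (n - j - k) j (by omega)
  unfold rot at b
  have n23 := h.ne23
  have n13 := h.ne13
  have n12 := h.ne12
  constructor
  · by_contra hlt
    have a1 := a.1 (by omega)
    by_cases hb : j + k ≤ σ
    · exact n23 (a1.symm.trans (b.1 hb))
    · exact n12 ((b.2 (by omega)).symm.trans a1)
  · by_contra hlt
    have b2 := b.2 (by omega)
    by_cases ha : n - j - k + j ≤ τ
    · exact n12 (b2.symm.trans (a.1 ha))
    · exact n13 (b2.symm.trans (a.2 (by omega)))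

variable [DecidableEq Λ]

/-- In the application `c` is about `n/3`: rows up to `c` are charged in extended form, the rows in
`(c, 2c]` without extension, and the remaining rows not at all. -/
def rowCost (n c : ℕ) (g : ℕ → ℕ → ℕ → Λ) : ℕ :=
  ∑ t ∈ Finset.Ioc c (2 * c), changes (row g n t) (n - t)

def extCost (n c : ℕ) (g : ℕ → ℕ → ℕ → Λ) : ℕ :=
  ∑ j ∈ Finset.range (c + 1), changes (extRow g n j) (n + j)

/-- The indices of the extended rows with a single change. -/
def cleanRows (n c : ℕ) (g : ℕ → ℕ → ℕ → Λ) : Finset ℕ :=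
  (Finset.range (c + 1)).filter fun j => changes (extRow g n j) (n + j) ≤ 1

/-- An extended row joins two vertices with different labels, so it has at least one change, and at
least two unless it is clean. -/
theorem extCost_ge (h : FaceLabeling n l₁ l₂ l₃ g) (hc : c ≤ n) :
    2 * (c + 1) ≤ extCost n c g + (cleanRows n c g).card := by
  unfold extCost cleanRows
  rw [Finset.card_filter, ← Finset.sum_add_distrib]
  calc 2 * (c + 1) = ∑ j ∈ Finset.range (c + 1), 2 := by simp [mul_comm]
    _ ≤ _ := Finset.sum_le_sum fun j hj => by
      rw [Finset.mem_range] at hj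
      have := one_le_changes (p := extRow g n j) (N := n + j) (i := 0) (j := n + j) (by omega)
        le_rfl (by rw [extRow_zero h, extRow_last h (by omega)]; exact h.ne23)
      split_ifs <;> omega

/-- A path that shows `r` distinct labels changes at least `r - 1` times. All additional labels
together are counted as one. -/
theorem sum_indicator_le_changes (h : FaceLabeling n l₁ l₂ l₃ g) (t : ℕ) [Decidable (RowHas n g l₁ t)]
    [Decidable (RowHas n g l₂ t)] [Decidable (RowHas n g l₃ t)]
    [Decidable (RowHasOther n l₁ l₂ l₃ g t)] :
    ((if RowHas n g l₁ t then 1 else 0) + (if RowHas n g l₂ t then 1 else 0)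
      + (if RowHas n g l₃ t then 1 else 0) + if RowHasOther n l₁ l₂ l₃ g t then 1 else 0)
      ≤ changes (row g n t) (n - t) + 1 := by
  refine le_trans ?_ (card_image_le_changes _ _)
  set S := (Finset.range (n - t + 1)).image (row g n t) with hS
  have hmem : ∀ {l}, RowHas n g l t → l ∈ S := by
    rintro l ⟨y, z, e, rfl⟩
    rw [← row_eq_of (g := g) e]
    exact Finset.mem_image_of_mem _ (by simp; omega)
  have key : ∀ (l : Λ) (T : Finset Λ) [Decidable (RowHas n g l t)], l ∉ T →
      ((if RowHas n g l t then 1 else 0) + (S.filter (· ∈ T)).card)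
        ≤ (S.filter (· ∈ insert l T)).card := by
    intro l T _ hT
    split_ifs with hl
    · have : S.filter (· ∈ insert l T) = insert l (S.filter (· ∈ T)) := by
        ext x
        simp only [Finset.mem_filter, Finset.mem_insert]
        constructor
        · rintro ⟨a, b⟩; tauto
        · rintro (rfl | ⟨a, b⟩)
          · exact ⟨hmem hl, Or.inl rfl⟩
          · exact ⟨a, Or.inr b⟩
      rw [this, Finset.card_insert_of_notMem (by simp [hT])]
      omega
    · rw [zero_add]
      exact Finset.card_le_card (Finset.monotone_filter_right _ fun x _ hx => Finset.mem_insert_of_mem hx)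
  have h3 := key l₃ ∅ (by simp)
  have h2 := key l₂ {l₃} (by simpa using h.ne23)
  have h1 := key l₁ {l₂, l₃} (by simpa using ⟨h.ne12, h.ne13⟩)
  have ho : ((if RowHasOther n l₁ l₂ l₃ g t then 1 else 0)
      + (S.filter (· ∈ ({l₁, l₂, l₃} : Finset Λ))).card) ≤ S.card := by
    split_ifs with hl
    · obtain ⟨y, z, e, n1, n2, n3⟩ := hl
      have : (S.filter (· ∈ ({l₁, l₂, l₃} : Finset Λ))).card < S.card := by
        apply Finset.card_lt_card
        rw [Finset.filter_ssubset]
        exact ⟨g t y z, hmem ⟨y, z, e, rfl⟩, by simp [n1, n2, n3]⟩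
      omega
    · rw [zero_add]
      exact Finset.card_filter_le _ _
  simp only [insert_empty_eq, Finset.notMem_empty, Finset.filter_false, Finset.card_empty] at h1 h2 h3
  omega

theorem rowCost_ge (h : FaceLabeling n l₁ l₂ l₃ g) :
    rowsWith n c g l₁ + rowsWith n c g l₂ + rowsWith n c g l₃ + rowsWithOther n c l₁ l₂ l₃ g
      ≤ rowCost n c g + c := by
  classical
  unfold rowsWith rowsWithOther rowCost
  simp only [Finset.card_filter]
  rw [← Finset.sum_add_distrib, ← Finset.sum_add_distrib, ← Finset.sum_add_distrib]
  calc _ ≤ ∑ t ∈ Finset.Ioc c (2 * c), (changes (row g n t) (n - t) + 1) :=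
        Finset.sum_le_sum fun t _ => by
          convert sum_indicator_le_changes h t
    _ = _ := by rw [Finset.sum_add_distrib]; simp; omega

/-- One end of each row lies on the side opposite to the second vertex, where `l₂` is forbidden; a
row containing `l₂` must therefore change. -/
theorem rowCost_ge_second (h : FaceLabeling n l₁ l₂ l₃ g) (hc : 2 * c ≤ n) :
    rowsWith n c g l₂ ≤ rowCost n c g := by
  classical
  unfold rowsWith rowCost
  rw [Finset.card_filter]
  refine Finset.sum_le_sum fun t ht => ?_
  rw [Finset.mem_Ioc] at ht
  split_ifs with hl
  · obtain ⟨y, z, e, hl⟩ := hl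
    refine one_le_changes (i := z) (j := n - t) (by omega) le_rfl ?_
    rw [row_eq_of e, row_eq_of (y := 0) (by omega), hl]
    exact (h.s2 _ _ (by omega)).symm
  · exact Nat.zero_le _

theorem rowCost_ge_third (h : FaceLabeling n l₁ l₂ l₃ g) (hc : 2 * c ≤ n) :
    rowsWith n c g l₃ ≤ rowCost n c g := by
  classical
  unfold rowsWith rowCost
  rw [Finset.card_filter]
  refine Finset.sum_le_sum fun t ht => ?_
  rw [Finset.mem_Ioc] at ht
  split_ifs with hl
  · obtain ⟨y, z, e, hl⟩ := hl
    refine one_le_changes (i := z) (j := 0) (by omega) (Nat.zero_le _) ?_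
    rw [row_eq_of e, row_eq_of (y := n - t) (by omega), hl]
    exact (h.s3 _ _ (by omega)).symm
  · exact Nat.zero_le _

theorem le_of_mem_cleanRows {j : ℕ} (hj : j ∈ cleanRows n c g) : j ≤ c := by
  unfold cleanRows at hj
  rw [Finset.mem_filter, Finset.mem_range] at hj
  omega

/-- The labels of a clean row are `l₂` up to a threshold, and `l₃` after it. -/
theorem exists_clean_threshold (h : FaceLabeling n l₁ l₂ l₃ g) (hc : c ≤ n) {j : ℕ}
    (hj : j ∈ cleanRows n c g) :
    ∃ τ, j ≤ τ ∧ τ < n ∧ ∀ y z, j + y + z = n →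
      (z + j ≤ τ → g j y z = l₂) ∧ (τ < z + j → g j y z = l₃) := by
  have hjc := le_of_mem_cleanRows hj
  unfold cleanRows at hj
  rw [Finset.mem_filter] at hj
  obtain ⟨τ, hτ, h1, h2⟩ := exists_threshold hj.2
    (by rw [extRow_zero h, extRow_last h (by omega)]; exact h.ne23)
  rw [extRow_zero h] at h1
  rw [extRow_last h (by omega)] at h2
  have e : ∀ y z, j + y + z = n → extRow g n j (z + j) = g j y z := by
    intro y z e
    unfold extRow; congr 1 <;> omega
  have key : ∀ y z, j + y + z = n →
      (z + j ≤ τ → g j y z = l₂) ∧ (τ < z + j → g j y z = l₃) := by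
    intro y z e'
    rw [← e y z e']
    exact ⟨fun hz => h1 _ hz, fun hz => h2 _ hz (by omega)⟩
  -- The ends of the unextended row lie on the sides that forbid `l₃` and `l₂`, so the single change
  -- happens within the row and not on an extension.
  refine ⟨τ, ?_, ?_, key⟩
  · by_contra hlt
    exact h.s3 j (n - j) (by omega) ((key (n - j) 0 (by omega)).2 (by omega))
  · by_contra hlt
    exact h.s2 j (n - j) (by omega) ((key 0 (n - j) (by omega)).1 (by omega))

end Face

/-! ### The cost of a triangle, by the directions that have clean rows. -/

section FaceCost

variable {Λ : Type*} [DecidableEq Λ] {n c : ℕ} {l₁ l₂ l₃ : Λ} {g : ℕ → ℕ → ℕ → Λ}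

/-- The cost of a labelling of a triangle: the changes along the rows in the middle third and the
changes along the extended rows in the outer third, in all three directions. -/
def faceCost (n c : ℕ) (g : ℕ → ℕ → ℕ → Λ) : ℕ :=
  (extCost n c g + rowCost n c g) + (extCost n c (rot g) + rowCost n c (rot g))
    + (extCost n c (rot (rot g)) + rowCost n c (rot (rot g)))

omit [DecidableEq Λ] in
theorem rot_rot_rot (g : ℕ → ℕ → ℕ → Λ) : rot (rot (rot g)) = g := rfl

theorem faceCost_rot (n c : ℕ) (g : ℕ → ℕ → ℕ → Λ) : faceCost n c (rot g) = faceCost n c g := by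
  unfold faceCost
  rw [rot_rot_rot]
  omega

theorem card_le_max_sub_min {S : Finset ℕ} (hS : S.Nonempty) :
    S.card + S.min' hS ≤ S.max' hS + 1 := by
  have : S ⊆ Finset.Icc (S.min' hS) (S.max' hS) := fun x hx =>
    Finset.mem_Icc.2 ⟨S.min'_le x hx, S.le_max' x hx⟩
  have h := Finset.card_le_card this
  rw [Nat.card_Icc] at h
  have := S.min'_le_max' hS
  omega

/-- The first and the last clean row of a direction, and what they imply for the other directions. -/
theorem exists_clean_data (h : FaceLabeling n l₁ l₂ l₃ g) (hc : 3 * c ≤ n)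
    (hS : (cleanRows n c g).Nonempty) :
    ∃ j J τ : ℕ, j ≤ J ∧ J ≤ c ∧ (cleanRows n c g).card + j ≤ J + 1 ∧ J ≤ τ ∧ τ < n ∧
      (0 ∈ cleanRows n c g → j = 0) ∧
      c ≤ rowsWith n c (rot g) l₃ + rowsWith n c (rot (rot g)) l₂ + j + 1 ∧
      c ≤ rowsWith n c (rot g) l₂ + (n - τ - 1 - c) ∧
      c ≤ rowsWith n c (rot (rot g)) l₃ + (τ - J - c) ∧
      ∀ y z, J + y + z = n → (z + J ≤ τ → g J y z = l₂) ∧ (τ < z + J → g J y z = l₃) := by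
  have hj := (cleanRows n c g).min'_mem hS
  have hJ := (cleanRows n c g).max'_mem hS
  obtain ⟨σ, hσ1, hσ2, hσ⟩ := exists_clean_threshold h (by omega) hj
  obtain ⟨τ, hτ1, hτ2, hτ⟩ := exists_clean_threshold h (by omega) hJ
  have hjc := le_of_mem_cleanRows hj
  have hJc := le_of_mem_cleanRows hJ
  obtain ⟨a1, -, a3, -⟩ := rowsWith_of_clean hc hjc hσ2 hσ
  obtain ⟨-, b2, -, b4⟩ := rowsWith_of_clean hc hJc hτ2 hτ
  refine ⟨_, _, τ, (cleanRows n c g).min'_le_max' hS, hJc, card_le_max_sub_min hS, hτ1, hτ2,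
    fun h0 => Nat.le_zero.1 (Finset.min'_le _ _ h0), ?_, b2, b4, hτ⟩
  generalize (cleanRows n c g).min' hS = j at *
  omega

/-- Here `gᵢ` stands for the number of middle rows of direction `i` that miss their own vertex label
`lᵢ`. A clean row `J` with threshold `τ` supplies these labels to the two other directions, and
moving `τ` only trades one shortage for the other. -/
theorem missing_pair {g₂ g₃ J τ : ℕ} (a1 : g₂ ≤ n - τ - 1 - c) (a2 : g₃ ≤ τ - J - c) :
    g₂ = 0 ∨ g₃ = 0 ∨ g₂ + g₃ + J + 1 + 2 * c ≤ n := by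
  omega

/-- The bound `J + K ≤ τ` comes from the crossing point of two clean rows, as in
`threshold_lt_of_clean`. -/
theorem missing_single {g₁ J K τ : ℕ} (a : g₁ ≤ n - τ - 1 - c) (b : J + K ≤ τ) :
    g₁ = 0 ∨ g₁ + J + K + 1 + c ≤ n := by
  omega

theorem sum_missing_le {g₁ g₂ g₃ J₁ J₂ J₃ : ℕ} (hn : n ≤ 3 * c + 2)
    (p1 : g₂ = 0 ∨ g₃ = 0 ∨ g₂ + g₃ + J₁ + 1 + 2 * c ≤ n)
    (p2 : g₃ = 0 ∨ g₁ = 0 ∨ g₃ + g₁ + J₂ + 1 + 2 * c ≤ n)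
    (p3 : g₁ = 0 ∨ g₂ = 0 ∨ g₁ + g₂ + J₃ + 1 + 2 * c ≤ n)
    (s1 : g₁ = 0 ∨ g₁ + J₂ + J₃ + 1 + c ≤ n) (s2 : g₂ = 0 ∨ g₂ + J₃ + J₁ + 1 + c ≤ n)
    (s3 : g₃ = 0 ∨ g₃ + J₁ + J₂ + 1 + c ≤ n)
    (h1 : J₁ ≤ c) (h2 : J₂ ≤ c) (h3 : J₃ ≤ c) :
    g₁ + g₂ + g₃ + J₁ + J₂ + J₃ ≤ 3 * c + 4 := by
  by_cases e1 : g₁ = 0 <;> by_cases e2 : g₂ = 0 <;> by_cases e3 : g₃ = 0 <;>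
    simp only [e1, e2, e3, true_or, or_true, false_or] at p1 p2 p3 s1 s2 s3 <;> omega

/-- Clean rows make the outer rows cheap, but the middle rows crossing them must then contain
several labels. The first clean row `jᵢ` forces foreign vertex labels in the other directions, the
last one `Jᵢ` forces own labels. The saving is at most `Jᵢ - jᵢ + 1`, and `sum_missing_le` shows
that the middle rows make up for it, with the additional labels left over as excess. -/
theorem faceCost_ge_of_three (h : FaceLabeling n l₁ l₂ l₃ g) (hc : 3 * c ≤ n) (hn : n ≤ 3 * c + 2)
    (h1 : (cleanRows n c g).Nonempty) (h2 : (cleanRows n c (rot g)).Nonempty)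
    (h3 : (cleanRows n c (rot (rot g))).Nonempty) :
    2 * n + rowsWithOther n c l₁ l₂ l₃ g + rowsWithOther n c l₂ l₃ l₁ (rot g)
      + rowsWithOther n c l₃ l₁ l₂ (rot (rot g)) ≤ faceCost n c g + 10 := by
  have hcn : c ≤ n := by omega
  obtain ⟨j₁, J₁, τ₁, a1, a2, a3, a4, a5, -, a6, a7, a8, a9⟩ := exists_clean_data h hc h1
  obtain ⟨j₂, J₂, τ₂, b1, b2, b3, b4, b5, -, b6, b7, b8, b9⟩ := exists_clean_data h.rot hc h2
  obtain ⟨j₃, J₃, τ₃, c1, c2, c3, c4, c5, -, c6, c7, c8, c9⟩ := exists_clean_data h.rot.rot hc h3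
  have i1 := (threshold_lt_of_clean h (by lia) a9 b9).2
  have i2 := (threshold_lt_of_clean h.rot (by lia) b9 c9).2
  have i3 := (threshold_lt_of_clean h.rot.rot (by lia) c9 a9).2
  rw [rot_rot_rot] at *
  have e1 := extCost_ge h hcn
  have e2 := extCost_ge h.rot hcn
  have e3 := extCost_ge h.rot.rot hcn
  have p1 := rowCost_ge (c := c) h
  have p2 := rowCost_ge (c := c) h.rot
  have p3 := rowCost_ge (c := c) h.rot.rot
  rw [← Nat.sub_le_iff_le_add'] at a7 a8 b7 b8 c7 c8
  have m := sum_missing_le hn (missing_pair a7 a8) (missing_pair b7 b8) (missing_pair c7 c8)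
    (missing_single c7 i2) (missing_single a7 i3) (missing_single b7 i1) a2 b2 c2
  clear a7 a8 b7 b8 c7 c8 i1 i2 i3 a1 b1 c1 a4 a5 b4 b5 c4 c5 a9 b9 c9 a2 b2 c2
  unfold faceCost
  have g1 := le_add_tsub (a := c) (b := rowsWith n c g l₁)
  have g2 := le_add_tsub (a := c) (b := rowsWith n c (rot g) l₂)
  have g3 := le_add_tsub (a := c) (b := rowsWith n c (rot (rot g)) l₃)
  generalize c - rowsWith n c g l₁ = x₁ at *
  generalize c - rowsWith n c (rot g) l₂ = x₂ at *
  generalize c - rowsWith n c (rot (rot g)) l₃ = x₃ at *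
  linarith

theorem faceCost_ge_of_two (h : FaceLabeling n l₁ l₂ l₃ g) (hc : 3 * c ≤ n) (hn : n ≤ 3 * c + 2)
    (h1 : (cleanRows n c g).Nonempty) (h2 : (cleanRows n c (rot g)).Nonempty)
    (h3 : cleanRows n c (rot (rot g)) = ∅) :
    2 * n + rowsWithOther n c l₃ l₁ l₂ (rot (rot g)) ≤ faceCost n c g + 10 ∧
    (0 ∈ cleanRows n c g → 0 ∈ cleanRows n c (rot g) →
      (2 * n + 2 * c ≤ faceCost n c g + (cleanRows n c g).card + (cleanRows n c (rot g)).card + 10 ∨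
      10 * n + rowsWithOther n c l₁ l₂ l₃ g + rowsWithOther n c l₂ l₃ l₁ (rot g)
        + rowsWithOther n c l₃ l₁ l₂ (rot (rot g)) ≤ 5 * faceCost n c g + 50)) := by
  have hcn : c ≤ n := by omega
  have hcn2 : 2 * c ≤ n := by omega
  obtain ⟨j₁, J₁, τ₁, a1, a2, a3, a4, a5, a0, a6, a7, a8, a9⟩ := exists_clean_data h hc h1
  obtain ⟨j₂, J₂, τ₂, b1, b2, b3, b4, b5, b0, b6, b7, b8, b9⟩ := exists_clean_data h.rot hc h2
  have i1 := (threshold_lt_of_clean h (by lia) a9 b9).2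
  rw [rot_rot_rot] at *
  have e1 := extCost_ge h hcn
  have e2 := extCost_ge h.rot hcn
  have e3 := extCost_ge h.rot.rot hcn
  rw [h3, Finset.card_empty] at e3
  have p1 := rowCost_ge (c := c) h
  have p2 := rowCost_ge (c := c) h.rot
  have p3 := rowCost_ge (c := c) h.rot.rot
  have q1 := rowCost_ge_third h hcn2
  have q2 := rowCost_ge_second h.rot hcn2
  rw [← Nat.sub_le_iff_le_add'] at a7 a8 b7 b8
  have m1 := missing_pair a7 a8
  have m2 := missing_pair b7 b8
  have m3 := missing_single b7 i1
  clear a7 a8 b7 b8 i1 a4 a5 b4 b5 a9 b9 h1 h2 h3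
  unfold faceCost
  have g1 := le_add_tsub (a := c) (b := rowsWith n c g l₁)
  have g2 := le_add_tsub (a := c) (b := rowsWith n c (rot g) l₂)
  have g3 := le_add_tsub (a := c) (b := rowsWith n c (rot (rot g)) l₃)
  generalize c - rowsWith n c g l₁ = x₁ at *
  generalize c - rowsWith n c (rot g) l₂ = x₂ at *
  generalize c - rowsWith n c (rot (rot g)) l₃ = x₃ at *
  constructor
  · rcases m3 with rfl | m3 <;> linarith
  · intro z1 z2
    replace a0 := a0 z1
    replace b0 := b0 z2
    subst a0 b0
    -- `x₃` counts the middle rows of the third direction without `l₃`. If there are none, nothing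
    -- is lost to missing labels and the only saving is the number of clean rows. Otherwise the
    -- bound from the crossing point becomes available and weighs the additional labels of all three
    -- directions against the excess.
    rcases Nat.eq_zero_or_pos x₃ with rfl | hx3
    · left; linarith
    · right
      replace m3 := m3.resolve_left hx3.ne'
      rcases m1 with rfl | m1
      · rcases m2 with m2 | rfl | m2
        · omega
        · linarith
        · linarith
      · replace m1 := m1.resolve_left hx3.ne'
        rcases m2 with m2 | rfl | m2
        · omega
        · linarith
        · linarith

/-- If `j` is the first clean row, at most `c - j + 1` changes are saved, and the labels on that row
force at least `c - j - 1` changes in middle rows of the two other directions. -/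
theorem faceCost_ge_of_one (h : FaceLabeling n l₁ l₂ l₃ g) (hc : 3 * c ≤ n) (hn : n ≤ 3 * c + 2)
    (h1 : (cleanRows n c g).Nonempty) (h2 : cleanRows n c (rot g) = ∅)
    (h3 : cleanRows n c (rot (rot g)) = ∅) :
    2 * n ≤ faceCost n c g + 10 := by
  obtain ⟨j₁, J₁, τ₁, a1, a2, a3, a4, a5, a0, a6, a7, a8, a9⟩ := exists_clean_data h hc h1
  have e1 := extCost_ge h (c := c) (by omega)
  have e2 := extCost_ge h.rot (c := c) (by omega)
  have e3 := extCost_ge h.rot.rot (c := c) (by omega)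
  rw [h3, Finset.card_empty] at e3
  rw [h2, Finset.card_empty] at e2
  have q1 := rowCost_ge_second (c := c) h.rot (by omega)
  have q2 := rowCost_ge_third (c := c) h.rot.rot (by omega)
  clear a7 a8
  unfold faceCost
  linarith

end FaceCost

/-! ### Lower bounds for the cost of a triangle. -/

section FaceCostLowerBounds

variable {Λ : Type*} [DecidableEq Λ] {n c : ℕ} {l₁ l₂ l₃ : Λ} {g : ℕ → ℕ → ℕ → Λ}

theorem le_rowCost_of_forall {m : ℕ}
    (hm : ∀ t, c < t → t ≤ 2 * c → t ≤ m → ∃ i ≤ n - t, ∃ j ≤ n - t, row g n t i ≠ row g n t j) :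
    min (2 * c) m ≤ rowCost n c g + c := by
  classical
  have h1 : ((Finset.Ioc c (2 * c)).filter (· ≤ m)).card ≤ rowCost n c g := by
    unfold rowCost
    rw [Finset.card_filter]
    refine Finset.sum_le_sum fun t ht => ?_
    rw [Finset.mem_Ioc] at ht
    split_ifs with h
    · obtain ⟨i, hi, j, hj, hij⟩ := hm t ht.1 ht.2 h
      exact one_le_changes hi hj hij
    · exact Nat.zero_le _
  have h2 := card_Ioc_inter_ge (c := c) (P := (· ≤ m)) (m := m) fun t _ _ h => h
  omega

/-- If one side is clean and the two other directions have no clean rows, the cost is large. -/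
theorem faceCost_ge_of_side (h : FaceLabeling n l₁ l₂ l₃ g) (hc : 3 * c ≤ n) (hn : n ≤ 3 * c + 2)
    (h1 : 0 ∈ cleanRows n c g) (h2 : cleanRows n c (rot g) = ∅)
    (h3 : cleanRows n c (rot (rot g)) = ∅) :
    6 * n + c ≤ 3 * faceCost n c g + 40 := by
  obtain ⟨j₁, J₁, τ₁, a1, a2, a3, a4, a5, a0, a6, a7, a8, a9⟩ := exists_clean_data h hc ⟨0, h1⟩
  obtain ⟨τ, -, hτ, key⟩ := exists_clean_threshold h (by omega) h1
  have hj := a0 h1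
  have e1 := extCost_ge h (c := c) (by omega)
  have e2 := extCost_ge h.rot (c := c) (by omega)
  have e3 := extCost_ge h.rot.rot (c := c) (by omega)
  rw [h3, Finset.card_empty] at e3
  rw [h2, Finset.card_empty] at e2
  have q1 := rowCost_ge_second (c := c) h.rot (by omega)
  have q2 := rowCost_ge_third (c := c) h.rot.rot (by omega)
  clear a7 a8 a9
  unfold faceCost
  -- The cutoff `4c/3` yields an excess of about `c/3` either way. A constant row `μ` has a label
  -- different from `l₂` and `l₃`, hence absent from the clean side, so in each other direction
  -- about `2c/3` or more middle rows meet both and change. If no such row is constant, the rows in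
  -- `(c, 4c/3]` all change.
  by_cases hμ : ∃ μ, c < μ ∧ 3 * μ ≤ 4 * c ∧ changes (row g n μ) (n - μ) = 0
  · obtain ⟨μ, hμ1, hμ2, hμ3⟩ := hμ
    have hconst := eq_of_changes_eq_zero hμ3
    have hx : ∀ y z, μ + y + z = n → g μ y z = g μ (n - μ) 0 := by
      intro y z e
      rw [← row_eq_of (g := g) e, ← row_eq_of (g := g) (show μ + (n - μ) + 0 = n by omega)]
      exact hconst z (by omega)
    have hne2 : g μ (n - μ) 0 ≠ l₂ := by
      rw [← hx 0 (n - μ) (by omega)]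
      exact h.s2 _ _ (by omega)
    have hne3 : g μ (n - μ) 0 ≠ l₃ := h.s3 _ _ (by omega)
    have hside : ∀ y z, y + z = n → g 0 y z ≠ g μ (n - μ) 0 := by
      intro y z e
      rcases le_or_gt z τ with hz | hz
      · rw [(key y z (by omega)).1 hz]; exact hne2.symm
      · rw [(key y z (by omega)).2 hz]; exact hne3.symm
    have r2 : min (2 * c) (n - μ) ≤ rowCost n c (rot g) + c := by
      refine le_rowCost_of_forall fun t ht1 ht2 ht3 => ⟨0, by omega, μ, by omega, ?_⟩
      rw [row_eq_of (show t + (n - t) + 0 = n by omega),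
        row_eq_of (show t + (n - t - μ) + μ = n by omega)]
      change g 0 t (n - t) ≠ g μ t (n - t - μ)
      rw [hx t (n - t - μ) (by omega)]
      exact hside _ _ (by omega)
    have r3 : min (2 * c) (n - μ) ≤ rowCost n c (rot (rot g)) + c := by
      refine le_rowCost_of_forall fun t ht1 ht2 ht3 => ⟨n - t, by omega, n - t - μ, by omega, ?_⟩
      rw [row_eq_of (show t + 0 + (n - t) = n by omega),
        row_eq_of (show t + μ + (n - t - μ) = n by omega)]
      change g 0 (n - t) t ≠ g μ (n - t - μ) t
      rw [hx (n - t - μ) t (by omega)]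
      exact hside _ _ (by omega)
    clear q1 q2 a6
    omega
  · push Not at hμ
    have r1 : min (2 * c) (4 * c / 3) ≤ rowCost n c g + c := by
      refine le_rowCost_of_forall fun t ht1 ht2 ht3 => ?_
      by_contra hcon
      push Not at hcon
      refine hμ t ht1 (by omega) ?_
      unfold changes
      rw [Finset.card_eq_zero, Finset.filter_eq_empty_iff]
      intro i hi
      rw [Finset.mem_range] at hi
      push Not
      exact hcon i (by omega) (i + 1) (by omega)
    clear hμ
    have r1' : c ≤ 3 * rowCost n c g + 3 := by omega
    clear r1
    linarith

/-- The cases are the sets of directions that have clean rows. Without any clean row, the extended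
rows alone cost `6(c + 1)`. -/
theorem le_faceCost (h : FaceLabeling n l₁ l₂ l₃ g) (hc : 3 * c ≤ n) (hn : n ≤ 3 * c + 2) :
    2 * n ≤ faceCost n c g + 10 := by
  rcases (cleanRows n c g).eq_empty_or_nonempty with h1 | h1 <;>
  rcases (cleanRows n c (rot g)).eq_empty_or_nonempty with h2 | h2 <;>
  rcases (cleanRows n c (rot (rot g))).eq_empty_or_nonempty with h3 | h3
  · have e1 := extCost_ge h (c := c) (by omega)
    have e2 := extCost_ge h.rot (c := c) (by omega)
    have e3 := extCost_ge h.rot.rot (c := c) (by omega)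
    rw [h1, Finset.card_empty] at e1
    rw [h2, Finset.card_empty] at e2
    rw [h3, Finset.card_empty] at e3
    unfold faceCost
    omega
  · have := faceCost_ge_of_one h.rot.rot hc hn h3 h1 h2
    rwa [faceCost_rot, faceCost_rot] at this
  · have := faceCost_ge_of_one h.rot hc hn h2 h3 h1
    rwa [faceCost_rot] at this
  · have := (faceCost_ge_of_two h.rot hc hn h2 h3 h1).1
    rw [faceCost_rot] at this
    omega
  · exact faceCost_ge_of_one h hc hn h1 h2 h3
  · have := (faceCost_ge_of_two h.rot.rot hc hn h3 h1 h2).1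
    rw [faceCost_rot, faceCost_rot] at this
    omega
  · have := (faceCost_ge_of_two h hc hn h1 h2 h3).1
    omega
  · have := faceCost_ge_of_three h hc hn h1 h2 h3
    omega

/-- Replace every label other than the three vertex labels by `l`. -/
def fillOther (l₁ l₂ l₃ l : Λ) (x : Λ) : Λ := if x = l₁ ∨ x = l₂ ∨ x = l₃ then x else l

/-- Stepwise: a change between two vertex labels survives all three fillings; a change between a
vertex label and an additional one survives exactly two, and the indicator sequence supplies the
third. -/
theorem changes_fillOther_le (h12 : l₁ ≠ l₂) (h13 : l₁ ≠ l₃) (h23 : l₂ ≠ l₃) (p : ℕ → Λ) (N : ℕ) :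
    changes (fun i => fillOther l₁ l₂ l₃ l₁ (p i)) N + changes (fun i => fillOther l₁ l₂ l₃ l₂ (p i)) N
      + changes (fun i => fillOther l₁ l₂ l₃ l₃ (p i)) N
      + changes (fun i => decide (p i = l₁ ∨ p i = l₂ ∨ p i = l₃)) N ≤ 3 * changes p N := by
  simp only [changes_eq_sum]
  rw [← Finset.sum_add_distrib, ← Finset.sum_add_distrib, ← Finset.sum_add_distrib, Finset.mul_sum]
  refine Finset.sum_le_sum fun i _ => ?_
  by_cases e : p i = p (i + 1)
  · simp [e]
  · rw [if_pos e]
    unfold fillOther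
    generalize p i = x at *
    generalize p (i + 1) = y at *
    by_cases hx : x = l₁ ∨ x = l₂ ∨ x = l₃ <;> by_cases hy : y = l₁ ∨ y = l₂ ∨ y = l₃
    · simp only [hx, hy, if_true]
      simp [e]
    · simp only [hx, hy, if_true, if_false]
      rcases hx with rfl | rfl | rfl <;> simp [*] <;> split_ifs <;> simp
    · simp only [hx, hy, if_true, if_false]
      rcases hy with rfl | rfl | rfl <;> simp [*] <;> split_ifs <;> simp
    · simp [hx, hy]

/-- Sides without additional labels are untouched by the filling, so no forbidden label can appear
on them. -/
theorem FaceLabeling.map_fillOther (h : FaceLabeling n l₁ l₂ l₃ g)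
    (s1 : ∀ y z, y + z = n → ¬(g 0 y z ≠ l₁ ∧ g 0 y z ≠ l₂ ∧ g 0 y z ≠ l₃))
    (s2 : ∀ y z, y + z = n → ¬(g z 0 y ≠ l₁ ∧ g z 0 y ≠ l₂ ∧ g z 0 y ≠ l₃))
    (s3 : ∀ y z, y + z = n → ¬(g y z 0 ≠ l₁ ∧ g y z 0 ≠ l₂ ∧ g y z 0 ≠ l₃)) (l : Λ) :
    FaceLabeling n l₁ l₂ l₃ (fun a b d => fillOther l₁ l₂ l₃ l (g a b d)) where
  ne12 := h.ne12
  ne13 := h.ne13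
  ne23 := h.ne23
  v1 := by simp [fillOther, h.v1]
  v2 := by simp [fillOther, h.v2]
  v3 := by simp [fillOther, h.v3]
  s1 := fun y z e => by
    unfold fillOther
    rw [if_pos (by have := s1 y z e; tauto)]
    exact h.s1 y z e
  s2 := fun z y e => by
    unfold fillOther
    rw [if_pos (by have := s2 y z (by omega); tauto)]
    exact h.s2 z y e
  s3 := fun y z e => by
    unfold fillOther
    rw [if_pos (by have := s3 y z e; tauto)]
    exact h.s3 y z e

open Classical in
/-- The number of rows `t ≤ 2c` that contain a label other than the vertex labels. -/
noncomputable def allRowsWithOther (n c : ℕ) (l₁ l₂ l₃ : Λ) (g : ℕ → ℕ → ℕ → Λ) : ℕ :=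
  ((Finset.range (2 * c + 1)).filter (RowHasOther n l₁ l₂ l₃ g)).card

theorem allRowsWithOther_le (h : FaceLabeling n l₁ l₂ l₃ g) (hc : 3 * c ≤ n)
    (s3 : ∀ y z, y + z = n → ¬(g y z 0 ≠ l₁ ∧ g y z 0 ≠ l₂ ∧ g y z 0 ≠ l₃)) (G : Λ → ℕ)
    (hG : ∀ l, G l = extCost n c (fun a b d => fillOther l₁ l₂ l₃ l (g a b d))
      + rowCost n c (fun a b d => fillOther l₁ l₂ l₃ l (g a b d))) :
    G l₁ + G l₂ + G l₃ + allRowsWithOther n c l₁ l₂ l₃ g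
      ≤ 3 * (extCost n c g + rowCost n c g) := by
  classical
  have hM : allRowsWithOther n c l₁ l₂ l₃ g =
      (∑ j ∈ Finset.range (c + 1), if RowHasOther n l₁ l₂ l₃ g j then 1 else 0)
      + ∑ t ∈ Finset.Ioc c (2 * c), if RowHasOther n l₁ l₂ l₃ g t then 1 else 0 := by
    have : Finset.range (2 * c + 1) = Finset.range (c + 1) ∪ Finset.Ioc c (2 * c) := by
      ext x
      simp only [Finset.mem_range, Finset.mem_union, Finset.mem_Ioc]
      omega
    rw [allRowsWithOther, Finset.card_filter, this, Finset.sum_union]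
    rw [Finset.disjoint_left]
    intro x hx hx'
    rw [Finset.mem_range] at hx
    rw [Finset.mem_Ioc] at hx'
    omega
  have key : ∀ (p : ℕ → Λ) (N i j : ℕ), i ≤ N → j ≤ N → (p i ≠ l₁ ∧ p i ≠ l₂ ∧ p i ≠ l₃) →
      ¬(p j ≠ l₁ ∧ p j ≠ l₂ ∧ p j ≠ l₃) →
      1 ≤ changes (fun i => decide (p i = l₁ ∨ p i = l₂ ∨ p i = l₃)) N := by
    intro p N i j hi hj h1 h2
    refine one_le_changes hi hj ?_
    rw [Ne, decide_eq_decide]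
    tauto
  have hext : ∀ j ∈ Finset.range (c + 1),
      (if RowHasOther n l₁ l₂ l₃ g j then 1 else 0) ≤
      changes (fun i => decide (extRow g n j i = l₁ ∨ extRow g n j i = l₂ ∨ extRow g n j i = l₃))
        (n + j) := by
    intro j hj
    rw [Finset.mem_range] at hj
    split_ifs with hr
    · obtain ⟨y, z, e, hr⟩ := hr
      refine key (extRow g n j) _ (z + j) 0 (by omega) (by omega) ?_ (by simp [extRow_zero h])
      have : extRow g n j (z + j) = g j y z := by
        unfold extRow; congr 1 <;> omega
      rwa [this]
    · exact Nat.zero_le _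
  have hrow : ∀ t ∈ Finset.Ioc c (2 * c),
      (if RowHasOther n l₁ l₂ l₃ g t then 1 else 0) ≤
      changes (fun i => decide (row g n t i = l₁ ∨ row g n t i = l₂ ∨ row g n t i = l₃))
        (n - t) := by
    intro t ht
    rw [Finset.mem_Ioc] at ht
    split_ifs with hr
    · obtain ⟨y, z, e, hr⟩ := hr
      refine key (row g n t) _ z 0 (by omega) (by omega) (by rwa [row_eq_of e]) ?_
      rw [row_eq_of (show t + (n - t) + 0 = n by omega)]
      exact s3 _ _ (by omega)
    · exact Nat.zero_le _
  have aux : ∀ (S : Finset ℕ) (p : ℕ → ℕ → Λ) (N r : ℕ → ℕ), (∀ t ∈ S, r t ≤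
      changes (fun i => decide (p t i = l₁ ∨ p t i = l₂ ∨ p t i = l₃)) (N t)) →
      (∑ t ∈ S, changes (fun i => fillOther l₁ l₂ l₃ l₁ (p t i)) (N t))
      + (∑ t ∈ S, changes (fun i => fillOther l₁ l₂ l₃ l₂ (p t i)) (N t))
      + (∑ t ∈ S, changes (fun i => fillOther l₁ l₂ l₃ l₃ (p t i)) (N t))
      + (∑ t ∈ S, r t) ≤ 3 * ∑ t ∈ S, changes (p t) (N t) := by
    intro S p N r hr
    rw [← Finset.sum_add_distrib, ← Finset.sum_add_distrib, ← Finset.sum_add_distrib,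
      Finset.mul_sum]
    refine Finset.sum_le_sum fun t ht => ?_
    have := changes_fillOther_le h.ne12 h.ne13 h.ne23 (p t) (N t)
    have := hr t ht
    omega
  have h1 := aux _ (extRow g n) (fun j => n + j) _ hext
  have h2 := aux _ (row g n) (fun t => n - t) _ hrow
  rw [hM, hG, hG, hG]
  unfold extCost rowCost
  have e1 : ∀ l j, changes (extRow (fun a b d => fillOther l₁ l₂ l₃ l (g a b d)) n j) (n + j)
    = changes (fun i => fillOther l₁ l₂ l₃ l (extRow g n j i)) (n + j) := fun _ _ => rfl
  have e2 : ∀ l j, changes (row (fun a b d => fillOther l₁ l₂ l₃ l (g a b d)) n j) (n - j)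
    = changes (fun i => fillOther l₁ l₂ l₃ l (row g n j i)) (n - j) := fun _ _ => rfl
  simp only [e1, e2]
  linarith

theorem side_of_clean (h : FaceLabeling n l₁ l₂ l₃ g) (hc : c ≤ n) (h0 : 0 ∈ cleanRows n c g) :
    ∀ y z, y + z = n → ¬(g 0 y z ≠ l₁ ∧ g 0 y z ≠ l₂ ∧ g 0 y z ≠ l₃) := by
  obtain ⟨τ, -, hτ, key⟩ := exists_clean_threshold h hc h0
  rintro y z e ⟨-, h2, h3⟩
  rcases le_or_gt z τ with hz | hz
  · exact h2 ((key y z (by omega)).1 hz)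
  · exact h3 ((key y z (by omega)).2 hz)

theorem fillOther_rotate (l₁ l₂ l₃ l : Λ) (x : Λ) :
    fillOther l₂ l₃ l₁ l x = fillOther l₁ l₂ l₃ l x := by
  unfold fillOther
  congr 1
  exact propext (by tauto)

/-- If all three sides are clean, then every row with an additional label adds to the cost. -/
theorem faceCost_ge_of_clean_sides (h : FaceLabeling n l₁ l₂ l₃ g) (hc : 3 * c ≤ n)
    (hn : n ≤ 3 * c + 2) (h1 : 0 ∈ cleanRows n c g) (h2 : 0 ∈ cleanRows n c (rot g))
    (h3 : 0 ∈ cleanRows n c (rot (rot g))) :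
    6 * n + allRowsWithOther n c l₁ l₂ l₃ g + allRowsWithOther n c l₂ l₃ l₁ (rot g)
      + allRowsWithOther n c l₃ l₁ l₂ (rot (rot g)) ≤ 3 * faceCost n c g + 30 := by
  have s1 := side_of_clean h (by omega) h1
  have s2 := side_of_clean h.rot (by omega) h2
  have s3 := side_of_clean h.rot.rot (by omega) h3
  have t1 := allRowsWithOther_le h hc (fun y z e => by have := s3 y z e; unfold rot at this; tauto)
    _ fun l => rfl
  have t2 := allRowsWithOther_le h.rot hc
    (fun y z e => by have := s1 y z e; unfold rot; tauto) _ fun l => rfl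
  have t3 := allRowsWithOther_le h.rot.rot hc
    (fun y z e => by have := s2 y z e; unfold rot at this ⊢; tauto) _ fun l => rfl
  have hf : ∀ l, 2 * n ≤ faceCost n c (fun a b d => fillOther l₁ l₂ l₃ l (g a b d)) + 10 := by
    intro l
    refine le_faceCost (h.map_fillOther s1 ?_ ?_ l) hc hn
    · intro y z e; have := s2 y z e; unfold rot at this; tauto
    · intro y z e; have := s3 y z e; unfold rot at this; tauto
  have f1 := hf l₁
  have f2 := hf l₂
  have f3 := hf l₃
  have r2 : ∀ l, (fun a b d => fillOther l₂ l₃ l₁ l (rot g a b d))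
      = rot (fun a b d => fillOther l₁ l₂ l₃ l (g a b d)) := by
    intro l; funext a b d; rw [fillOther_rotate]; rfl
  have r3 : ∀ l, (fun a b d => fillOther l₃ l₁ l₂ l (rot (rot g) a b d))
      = rot (rot (fun a b d => fillOther l₁ l₂ l₃ l (g a b d))) := by
    intro l; funext a b d; rw [fillOther_rotate, fillOther_rotate]; rfl
  rw [r2, r2, r2] at t2
  rw [r3, r3, r3] at t3
  unfold faceCost at *
  linarith

end FaceCostLowerBounds

/-! ### Counting the points with an additional label outside the corners. -/

section Area

variable {Λ : Type*} {n c m : ℕ} {l₁ l₂ l₃ : Λ} {g : ℕ → ℕ → ℕ → Λ}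

open Classical in
/-- The points of the triangle outside the three corners of size `m` that have a label other than
the vertex labels. -/
noncomputable def innerOthers (n m : ℕ) (l₁ l₂ l₃ : Λ) (g : ℕ → ℕ → ℕ → Λ) : Finset (ℕ × ℕ × ℕ) :=
  (Finset.range (n + 1) ×ˢ Finset.range (n + 1) ×ˢ Finset.range (n + 1)).filter fun p =>
    p.1 + p.2.1 + p.2.2 = n ∧ (p.1 ≤ n - m ∧ p.2.1 ≤ n - m ∧ p.2.2 ≤ n - m) ∧
      (g p.1 p.2.1 p.2.2 ≠ l₁ ∧ g p.1 p.2.1 p.2.2 ≠ l₂ ∧ g p.1 p.2.1 p.2.2 ≠ l₃)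

theorem mem_innerOthers {a b d : ℕ} : (a, b, d) ∈ innerOthers n m l₁ l₂ l₃ g ↔
    a + b + d = n ∧ (a ≤ n - m ∧ b ≤ n - m ∧ d ≤ n - m) ∧
      (g a b d ≠ l₁ ∧ g a b d ≠ l₂ ∧ g a b d ≠ l₃) := by
  unfold innerOthers
  simp only [Finset.mem_filter, Finset.mem_product, Finset.mem_range]
  constructor
  · rintro ⟨-, h⟩; exact h
  · intro h; exact ⟨by omega, h⟩

theorem card_innerOthers_rot :
    (innerOthers n m l₂ l₃ l₁ (rot g)).card = (innerOthers n m l₁ l₂ l₃ g).card := by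
  refine Finset.card_bij' (fun p _ => (p.2.2, p.1, p.2.1)) (fun p _ => (p.2.1, p.2.2, p.1))
    ?_ ?_ (fun _ _ => rfl) (fun _ _ => rfl)
  · rintro ⟨a, b, d⟩ h
    rw [mem_innerOthers] at h ⊢
    dsimp only
    unfold rot at h
    exact ⟨by omega, by tauto, by tauto⟩
  · rintro ⟨a, b, d⟩ h
    rw [mem_innerOthers] at h ⊢
    dsimp only
    unfold rot
    exact ⟨by omega, by tauto, by tauto⟩

theorem card_le_sum_card {α : Type*} (S : Finset α) (x y : α → ℕ) (T : Finset ℕ) (I : ℕ → Finset ℕ)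
    (hT : ∀ p ∈ S, x p ∈ T ∧ y p ∈ I (x p))
    (hinj : ∀ p ∈ S, ∀ q ∈ S, x p = x q → y p = y q → p = q) :
    S.card ≤ ∑ t ∈ T, (I t).card := by
  rw [← Finset.card_sigma]
  refine Finset.card_le_card_of_injOn (fun p => ⟨x p, y p⟩) (fun p hp => ?_) ?_
  · exact Finset.mem_sigma.2 (hT p hp)
  · intro p hp q hq e
    simp only [Sigma.mk.injEq, heq_eq_eq] at e
    exact hinj p hp q hq e.1 e.2

/-- The number of points in the row with first coordinate `t`, outside the two adjacent corners. -/
def rowWidth (n m t : ℕ) : ℕ := n + 1 - t - 2 * (m - t)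

theorem card_filter_innerOthers_le (hm : 2 * m ≤ n) (P : ℕ × ℕ × ℕ → Prop) [DecidablePred P]
    (T : Finset ℕ) (hT : ∀ p ∈ innerOthers n m l₁ l₂ l₃ g, P p → p.1 ∈ T) :
    ((innerOthers n m l₁ l₂ l₃ g).filter P).card ≤ ∑ t ∈ T, rowWidth n m t := by
  refine (card_le_sum_card _ (fun p => p.1) (fun p => p.2.1) T
    (fun t => Finset.Ico (m - t) (n + 1 - t - (m - t))) ?_ ?_).trans_eq ?_
  · rintro ⟨a, b, d⟩ h
    rw [Finset.mem_filter] at h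
    refine ⟨hT _ h.1 h.2, ?_⟩
    have := mem_innerOthers.1 h.1
    rw [Finset.mem_Ico]
    dsimp only
    omega
  · rintro ⟨a, b, d⟩ h ⟨a', b', d'⟩ h' e1 e2
    rw [Finset.mem_filter] at h h'
    have h1 := mem_innerOthers.1 h.1
    have h2 := mem_innerOthers.1 h'.1
    dsimp only at e1 e2
    subst e1 e2
    rw [show d = d' by omega]
  · refine Finset.sum_congr rfl fun t _ => ?_
    rw [Nat.card_Ico]
    unfold rowWidth
    omega

theorem rowWidth_le (n m t : ℕ) : rowWidth n m t ≤ n + 1 - t := by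
  unfold rowWidth; omega

theorem sum_range_rowWidth {k : ℕ} (hm : 2 * m ≤ n) (hmk : m ≤ k) (hk : k ≤ n + 1) :
    2 * ∑ t ∈ Finset.range k, (rowWidth n m t : ℤ) = k * (2 * n + 3 - k) - 2 * (m * (m + 1)) := by
  have h1 : ∀ k : ℕ, k ≤ n + 1 →
      2 * ∑ t ∈ Finset.range k, ((n : ℤ) + 1 - t) = k * (2 * n + 3 - k) := by
    intro k hk
    induction k with
    | zero => simp
    | succ k ih =>
      rw [Finset.sum_range_succ, mul_add, ih (by omega)]
      push_cast
      ring
  have h2 : ∀ k : ℕ, k ≤ m →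
      2 * ∑ t ∈ Finset.range k, ((m - t : ℕ) : ℤ) = k * (2 * m + 1 - k) := by
    intro k hk
    induction k with
    | zero => simp
    | succ k ih =>
      rw [Finset.sum_range_succ, mul_add, ih (by omega)]
      push_cast [show k ≤ m by omega]
      ring
  have h3 : ∑ t ∈ Finset.range k, ((m - t : ℕ) : ℤ) = ∑ t ∈ Finset.range m, ((m - t : ℕ) : ℤ) := by
    refine (Finset.sum_subset (Finset.range_mono hmk) fun t _ ht => ?_).symm
    rw [Finset.mem_range] at ht
    rw [show m - t = 0 by omega, Nat.cast_zero]
  have h4 : ∀ t ∈ Finset.range k, (rowWidth n m t : ℤ) = ((n : ℤ) + 1 - t) - 2 * ((m - t : ℕ) : ℤ) := by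
    intro t ht
    rw [Finset.mem_range] at ht
    unfold rowWidth
    omega
  rw [Finset.sum_congr rfl h4, Finset.sum_sub_distrib, ← Finset.mul_sum, mul_sub, h1 k hk, h3, h2 m le_rfl]
  ring

/-- With `c ≈ n/3` and `m ≈ n/6`, the area is `((1/3)^2 - (1/6)^2)/2 = 1/24` in units of `n^2`. -/
theorem sum_rowWidth_outer (hc : 3 * c ≤ n) (hc' : n ≤ 3 * c + 2) (hm : 6 * m ≤ n)
    (hm' : n ≤ 6 * m + 5) :
    24 * ∑ t ∈ Finset.Ioc (2 * c) (n - m), rowWidth n m t ≤ n ^ 2 + 200 * (n + 1) := by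
  have e : Finset.range (n - m + 1) = Finset.range (2 * c + 1) ∪ Finset.Ioc (2 * c) (n - m) := by
    ext x
    simp only [Finset.mem_range, Finset.mem_union, Finset.mem_Ioc]
    omega
  have hd : Disjoint (Finset.range (2 * c + 1)) (Finset.Ioc (2 * c) (n - m)) := by
    rw [Finset.disjoint_left]
    intro x hx hx'
    rw [Finset.mem_range] at hx
    rw [Finset.mem_Ioc] at hx'
    omega
  have h1 := sum_range_rowWidth (n := n) (m := m) (k := n - m + 1) (by omega) (by omega) (by omega)
  have h2 := sum_range_rowWidth (n := n) (m := m) (k := 2 * c + 1) (by omega) (by omega) (by omega)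
  rw [e, Finset.sum_union hd] at h1
  zify
  push_cast [show m ≤ n by omega] at h1 h2 ⊢
  zify at hc hc' hm hm'
  nlinarith

theorem sum_rowWidth_inner (hc : 3 * c ≤ n) (hc' : n ≤ 3 * c + 2) (hm : 6 * m ≤ n)
    (hm' : n ≤ 6 * m + 5) :
    4 * ∑ t ∈ Finset.range (c + 1), rowWidth n m t ≤ n ^ 2 + 40 * (n + 1) := by
  have h1 := sum_range_rowWidth (n := n) (m := m) (k := c + 1) (by omega) (by omega) (by omega)
  zify
  push_cast at h1 ⊢
  zify at hc hc' hm hm'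
  nlinarith

/-- The whole triangle has area `1/2` in units of `n^2`, and the three removed corners have area
`1/72` each, which leaves `11/24`. -/
theorem sum_rowWidth_all (hm : 6 * m ≤ n) (hm' : n ≤ 6 * m + 5) :
    24 * ∑ t ∈ Finset.range (n - m + 1), rowWidth n m t ≤ 11 * n ^ 2 + 200 * (n + 1) := by
  have h1 := sum_range_rowWidth (n := n) (m := m) (k := n - m + 1) (by omega) (by omega) (by omega)
  zify
  push_cast [show m ≤ n by omega] at h1 ⊢
  zify at hm hm'
  nlinarith

theorem card_innerOthers_le (hm : 2 * m ≤ n) :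
    (innerOthers n m l₁ l₂ l₃ g).card ≤ ∑ t ∈ Finset.range (n - m + 1), rowWidth n m t := by
  classical
  have := card_filter_innerOthers_le (l₁ := l₁) (l₂ := l₂) (l₃ := l₃) (g := g) hm (fun _ => True)
    (Finset.range (n - m + 1)) (by
      rintro ⟨a, b, d⟩ h -
      have := mem_innerOthers.1 h
      rw [Finset.mem_range]
      dsimp only
      omega)
  simpa using this

theorem card_middle_le (hm : 2 * m ≤ n) :
    ((innerOthers n m l₁ l₂ l₃ g).filter fun p => c < p.1 ∧ p.1 ≤ 2 * c).card
      ≤ (n - c) * rowsWithOther n c l₁ l₂ l₃ g := by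
  classical
  refine (card_filter_innerOthers_le hm _
    ((Finset.Ioc c (2 * c)).filter (RowHasOther n l₁ l₂ l₃ g)) ?_).trans ?_
  · rintro ⟨a, b, d⟩ h h'
    have := mem_innerOthers.1 h
    rw [Finset.mem_filter, Finset.mem_Ioc]
    exact ⟨h', b, d, this.1, this.2.2⟩
  · unfold rowsWithOther
    refine (Finset.sum_le_card_nsmul _ _ (n - c) fun t ht => ?_).trans_eq
      (by rw [smul_eq_mul, mul_comm])
    rw [Finset.mem_filter, Finset.mem_Ioc] at ht
    have := rowWidth_le n m t
    omega

theorem card_outer_le (hm : 2 * m ≤ n) :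
    ((innerOthers n m l₁ l₂ l₃ g).filter fun p => 2 * c < p.1).card
      ≤ ∑ t ∈ Finset.Ioc (2 * c) (n - m), rowWidth n m t := by
  refine card_filter_innerOthers_le hm _ _ ?_
  rintro ⟨a, b, d⟩ h h'
  have := mem_innerOthers.1 h
  rw [Finset.mem_Ioc]
  dsimp only at h' ⊢
  omega

theorem card_innerOthers_le_direction (hm : 2 * m ≤ n) :
    (innerOthers n m l₁ l₂ l₃ g).card ≤ (n - c) * rowsWithOther n c l₁ l₂ l₃ g
      + ∑ t ∈ Finset.Ioc (2 * c) (n - m), rowWidth n m t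
      + ∑ t ∈ Finset.range (c + 1), rowWidth n m t := by
  classical
  have h1 := card_middle_le (c := c) (l₁ := l₁) (l₂ := l₂) (l₃ := l₃) (g := g) hm
  have h2 := card_outer_le (c := c) (l₁ := l₁) (l₂ := l₂) (l₃ := l₃) (g := g) hm
  have h3 := card_filter_innerOthers_le (l₁ := l₁) (l₂ := l₂) (l₃ := l₃) (g := g) hm
    (fun p => p.1 ≤ c) (Finset.range (c + 1)) (fun p _ hp => by rw [Finset.mem_range]; omega)
  have h4 : (innerOthers n m l₁ l₂ l₃ g).card ≤
      ((innerOthers n m l₁ l₂ l₃ g).filter (fun p => c < p.1 ∧ p.1 ≤ 2 * c) ∪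
      (innerOthers n m l₁ l₂ l₃ g).filter (fun p => 2 * c < p.1) ∪
      (innerOthers n m l₁ l₂ l₃ g).filter (fun p => p.1 ≤ c)).card := by
    refine Finset.card_le_card fun p hp => ?_
    simp only [Finset.mem_union, Finset.mem_filter]
    rcases le_or_gt p.1 c with h | h
    · exact Or.inr ⟨hp, h⟩
    · rcases le_or_gt p.1 (2 * c) with h' | h'
      · exact Or.inl (Or.inl ⟨hp, h, h'⟩)
      · exact Or.inl (Or.inr ⟨hp, h'⟩)
  have h5 := Finset.card_union_le ((innerOthers n m l₁ l₂ l₃ g).filter (fun p => c < p.1 ∧ p.1 ≤ 2 * c) ∪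
      (innerOthers n m l₁ l₂ l₃ g).filter (fun p => 2 * c < p.1))
      ((innerOthers n m l₁ l₂ l₃ g).filter (fun p => p.1 ≤ c))
  have h6 := Finset.card_union_le ((innerOthers n m l₁ l₂ l₃ g).filter (fun p => c < p.1 ∧ p.1 ≤ 2 * c))
      ((innerOthers n m l₁ l₂ l₃ g).filter (fun p => 2 * c < p.1))
  omega

theorem card_filter_rot (P : ℕ × ℕ × ℕ → Prop) [DecidablePred P] :
    ((innerOthers n m l₂ l₃ l₁ (rot g)).filter P).card =
      ((innerOthers n m l₁ l₂ l₃ g).filter fun p => P (p.2.1, p.2.2, p.1)).card := by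
  refine Finset.card_bij' (fun p _ => (p.2.2, p.1, p.2.1)) (fun p _ => (p.2.1, p.2.2, p.1))
    ?_ ?_ (fun _ _ => rfl) (fun _ _ => rfl)
  · rintro ⟨a, b, d⟩ h
    rw [Finset.mem_filter, mem_innerOthers] at h ⊢
    dsimp only at h ⊢
    unfold rot at h
    exact ⟨⟨by omega, by tauto, by tauto⟩, h.2⟩
  · rintro ⟨a, b, d⟩ h
    rw [Finset.mem_filter, mem_innerOthers] at h ⊢
    dsimp only at h ⊢
    unfold rot
    exact ⟨⟨by omega, by tauto, by tauto⟩, h.2⟩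

theorem card_innerOthers_le_three (hc : 3 * c ≤ n) (hm : 2 * m ≤ n) :
    (innerOthers n m l₁ l₂ l₃ g).card ≤ (n - c) * (rowsWithOther n c l₁ l₂ l₃ g
      + rowsWithOther n c l₂ l₃ l₁ (rot g) + rowsWithOther n c l₃ l₁ l₂ (rot (rot g)))
      + 3 * (∑ t ∈ Finset.Ioc (2 * c) (n - m), rowWidth n m t) + 1 := by
  classical
  set S := innerOthers n m l₁ l₂ l₃ g with hS
  have h1 := card_middle_le (c := c) (l₁ := l₁) (l₂ := l₂) (l₃ := l₃) (g := g) hm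
  have h2 := card_outer_le (c := c) (l₁ := l₁) (l₂ := l₂) (l₃ := l₃) (g := g) hm
  have h3 := card_middle_le (c := c) (l₁ := l₂) (l₂ := l₃) (l₃ := l₁) (g := rot g) hm
  have h4 := card_outer_le (c := c) (l₁ := l₂) (l₂ := l₃) (l₃ := l₁) (g := rot g) hm
  have h5 := card_middle_le (c := c) (l₁ := l₃) (l₂ := l₁) (l₃ := l₂) (g := rot (rot g)) hm
  have h6 := card_outer_le (c := c) (l₁ := l₃) (l₂ := l₁) (l₃ := l₂) (g := rot (rot g)) hm
  rw [card_filter_rot] at h3 h4 h5 h6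
  rw [card_filter_rot] at h5 h6
  dsimp only at h3 h4 h5 h6
  rw [← hS] at h1 h2 h3 h4 h5 h6
  -- Since `3c ≤ n`, only the point `(c, c, c)` can escape the middle and last thirds of all
  -- directions.
  have h7 : (S.filter fun p => p.1 ≤ c ∧ p.2.1 ≤ c ∧ p.2.2 ≤ c).card ≤ 1 := by
    rw [Finset.card_le_one]
    rintro ⟨a, b, d⟩ h ⟨a', b', d'⟩ h'
    rw [Finset.mem_filter, hS, mem_innerOthers] at h h'
    dsimp only at h h'
    rw [show a = a' by omega, show b = b' by omega, show d = d' by omega]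
  have h8 : S ⊆ (S.filter fun p => c < p.1 ∧ p.1 ≤ 2 * c) ∪ (S.filter fun p => 2 * c < p.1) ∪
      ((S.filter fun p => c < p.2.1 ∧ p.2.1 ≤ 2 * c) ∪ (S.filter fun p => 2 * c < p.2.1)) ∪
      ((S.filter fun p => c < p.2.2 ∧ p.2.2 ≤ 2 * c) ∪ (S.filter fun p => 2 * c < p.2.2)) ∪
      (S.filter fun p => p.1 ≤ c ∧ p.2.1 ≤ c ∧ p.2.2 ≤ c) := by
    intro p hp
    simp only [Finset.mem_union, Finset.mem_filter, hp, true_and]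
    omega
  have h9 := Finset.card_le_card h8
  have u : ∀ A B : Finset (ℕ × ℕ × ℕ), ∀ a b : ℕ, A.card ≤ a → B.card ≤ b → (A ∪ B).card ≤ a + b :=
    fun A B a b ha hb => (Finset.card_union_le A B).trans (by omega)
  have h10 := u _ _ _ _ (u _ _ _ _ (u _ _ _ _ (u _ _ _ _ h1 h2) (u _ _ _ _ h3 h4)) (u _ _ _ _ h5 h6)) h7
  refine (h9.trans h10).trans (le_of_eq ?_)
  ring

theorem card_innerOthers_le_allRows (hc : 3 * c ≤ n) (hc' : n ≤ 3 * c + 2) (hm : 2 * m ≤ n) (hc2 : 2 ≤ c) :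
    (innerOthers n m l₁ l₂ l₃ g).card ≤ (n + 1) * (allRowsWithOther n c l₁ l₂ l₃ g
      + allRowsWithOther n c l₂ l₃ l₁ (rot g)) := by
  classical
  have aux : ∀ (l₁ l₂ l₃ : Λ) (g : ℕ → ℕ → ℕ → Λ),
      ((innerOthers n m l₁ l₂ l₃ g).filter fun p => p.1 ≤ 2 * c).card
        ≤ (n + 1) * allRowsWithOther n c l₁ l₂ l₃ g := by
    intro l₁ l₂ l₃ g
    refine (card_filter_innerOthers_le hm _
      ((Finset.range (2 * c + 1)).filter (RowHasOther n l₁ l₂ l₃ g)) ?_).trans ?_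
    · rintro ⟨a, b, d⟩ h h'
      have := mem_innerOthers.1 h
      rw [Finset.mem_filter, Finset.mem_range]
      exact ⟨by omega, b, d, this.1, this.2.2⟩
    · unfold allRowsWithOther
      refine (Finset.sum_le_card_nsmul _ _ (n + 1) fun t ht => ?_).trans_eq
        (by rw [smul_eq_mul, mul_comm])
      have := rowWidth_le n m t
      omega
  have h1 := aux l₁ l₂ l₃ g
  have h2 := aux l₂ l₃ l₁ (rot g)
  rw [card_filter_rot] at h2
  have h3 : innerOthers n m l₁ l₂ l₃ g ⊆
      (innerOthers n m l₁ l₂ l₃ g).filter (fun p => p.1 ≤ 2 * c) ∪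
      (innerOthers n m l₁ l₂ l₃ g).filter (fun p => p.2.1 ≤ 2 * c) := by
    rintro ⟨a, b, d⟩ hp
    have := mem_innerOthers.1 hp
    simp only [Finset.mem_union, Finset.mem_filter, hp, true_and]
    omega
  have h4 := (Finset.card_le_card h3).trans (Finset.card_union_le _ _)
  dsimp only at h2
  rw [mul_add]
  omega

variable [DecidableEq Λ]

/-- Clean rows carry no additional label. So such points lie on an outer row of one of two
directions that is not clean, or have both coordinates above `c`, which confines them to a square.
-/
theorem card_innerOthers_le_clean (h : FaceLabeling n l₁ l₂ l₃ g) (hc : 3 * c ≤ n) (hm : 2 * m ≤ n) :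
    (innerOthers n m l₁ l₂ l₃ g).card ≤ (n + 1) * (c + 1 - (cleanRows n c g).card)
      + (n + 1) * (c + 1 - (cleanRows n c (rot g)).card) + (n - 2 * c) * (n - 2 * c) := by
  have aux : ∀ {l₁ l₂ l₃ : Λ} {g : ℕ → ℕ → ℕ → Λ}, FaceLabeling n l₁ l₂ l₃ g →
      ((innerOthers n m l₁ l₂ l₃ g).filter fun p => p.1 ≤ c).card
        ≤ (n + 1) * (c + 1 - (cleanRows n c g).card) := by
    intro l₁ l₂ l₃ g h
    refine (card_filter_innerOthers_le hm _ (Finset.range (c + 1) \ cleanRows n c g) ?_).trans ?_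
    · rintro ⟨a, b, d⟩ hp h'
      have hp := mem_innerOthers.1 hp
      rw [Finset.mem_sdiff, Finset.mem_range]
      refine ⟨by omega, fun hcl => ?_⟩
      obtain ⟨τ, -, hτ, key⟩ := exists_clean_threshold h (by omega) hcl
      have := key b d hp.1
      dsimp only at this
      rcases le_or_gt (d + a) τ with hz | hz
      · exact hp.2.2.2.1 (this.1 hz)
      · exact hp.2.2.2.2 (this.2 hz)
    · have hsub : cleanRows n c g ⊆ Finset.range (c + 1) := Finset.filter_subset _ _
      have hcard : c + 1 - (cleanRows n c g).card = (Finset.range (c + 1) \ cleanRows n c g).card := by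
        rw [Finset.card_sdiff_of_subset hsub, Finset.card_range]
      rw [hcard]
      refine (Finset.sum_le_card_nsmul _ _ (n + 1) fun t ht => ?_).trans_eq
        (by rw [smul_eq_mul, mul_comm])
      have := rowWidth_le n m t
      omega
  have h1 := aux h
  have h2 := aux h.rot
  rw [card_filter_rot] at h2
  have h3 : ((innerOthers n m l₁ l₂ l₃ g).filter fun p => c < p.1 ∧ c < p.2.1).card
      ≤ (n - 2 * c) * (n - 2 * c) := by
    refine (card_le_sum_card _ (fun p => p.1) (fun p => p.2.1) (Finset.Ico c (n - c))
      (fun _ => Finset.Ico c (n - c)) ?_ ?_).trans_eq ?_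
    · rintro ⟨a, b, d⟩ hp
      rw [Finset.mem_filter, mem_innerOthers] at hp
      dsimp only at hp ⊢
      rw [Finset.mem_Ico, Finset.mem_Ico]
      omega
    · rintro ⟨a, b, d⟩ hp ⟨a', b', d'⟩ hp' e1 e2
      rw [Finset.mem_filter, mem_innerOthers] at hp hp'
      dsimp only at e1 e2
      subst e1 e2
      rw [show d = d' by omega]
    · rw [Finset.sum_const, Nat.card_Ico, smul_eq_mul, show n - c - c = n - 2 * c by omega]
  have h4 : innerOthers n m l₁ l₂ l₃ g ⊆
      (innerOthers n m l₁ l₂ l₃ g).filter (fun p => p.1 ≤ c) ∪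
      (innerOthers n m l₁ l₂ l₃ g).filter (fun p => p.2.1 ≤ c) ∪
      (innerOthers n m l₁ l₂ l₃ g).filter (fun p => c < p.1 ∧ c < p.2.1) := by
    rintro ⟨a, b, d⟩ hp
    simp only [Finset.mem_union, Finset.mem_filter, hp, true_and]
    omega
  have h5 := (Finset.card_le_card h4).trans (Finset.card_union_le _ _)
  have h6 := Finset.card_union_le ((innerOthers n m l₁ l₂ l₃ g).filter (fun p => p.1 ≤ c))
    ((innerOthers n m l₁ l₂ l₃ g).filter (fun p => p.2.1 ≤ c))
  dsimp only at h2
  linarith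

end Area

/-! ### Additional labels against excess cost and fragmented sides. -/

section FaceInequality

variable {Λ : Type*} [DecidableEq Λ] {n c m : ℕ} {l₁ l₂ l₃ : Λ} {g : ℕ → ℕ → ℕ → Λ}

/-- The number of changes along the three sides of the triangle. -/
def sideCost (n : ℕ) (g : ℕ → ℕ → ℕ → Λ) : ℕ :=
  changes (extRow g n 0) n + changes (extRow (rot g) n 0) n + changes (extRow (rot (rot g)) n 0) n

theorem sideCost_rot (n : ℕ) (g : ℕ → ℕ → ℕ → Λ) : sideCost n (rot g) = sideCost n g := by
  unfold sideCost
  rw [rot_rot_rot]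
  omega

theorem one_le_changes_side (h : FaceLabeling n l₁ l₂ l₃ g) : 1 ≤ changes (extRow g n 0) n :=
  one_le_changes (i := 0) (j := n) (by omega) le_rfl
    (by
      have := extRow_last h (Nat.zero_le n)
      rw [add_zero] at this
      rw [extRow_zero h, this]; exact h.ne23)

theorem two_le_changes_side (h0 : 0 ∉ cleanRows n c g) : 2 ≤ changes (extRow g n 0) n := by
  unfold cleanRows at h0
  rw [Finset.mem_filter, Finset.mem_range] at h0
  rw [add_zero] at h0
  by_contra hlt
  exact h0 ⟨by omega, by omega⟩

theorem card_cleanRows_le (n c : ℕ) (g : ℕ → ℕ → ℕ → Λ) : (cleanRows n c g).card ≤ c + 1 :=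
  (Finset.card_filter_le _ _).trans_eq (Finset.card_range _)

/-- The inequality that relates the cost of a labelling of a triangle, the number of its
fragmented sides, and the number of points with an additional label. -/
def FaceBound (n c m : ℕ) (l₁ l₂ l₃ : Λ) (g : ℕ → ℕ → ℕ → Λ) : Prop :=
  72 * ((innerOthers n m l₁ l₂ l₃ g).card : ℝ) ≤
    384 * n * ((faceCost n c g : ℝ) - 2 * n) + 11 * ((sideCost n g : ℝ) - 3) * n ^ 2 + 100000 * n

theorem faceBound_rot (hb : FaceBound n c m l₂ l₃ l₁ (rot g)) : FaceBound n c m l₁ l₂ l₃ g := by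
  unfold FaceBound at *
  rwa [card_innerOthers_rot, faceCost_rot, sideCost_rot] at hb

theorem faceBound_of_three (h : FaceLabeling n l₁ l₂ l₃ g) (hn : 100 ≤ n) (hc : 3 * c ≤ n)
    (hc' : n ≤ 3 * c + 2) (hm : 6 * m ≤ n) (hm' : n ≤ 6 * m + 5)
    (h1 : (cleanRows n c g).Nonempty) (h2 : (cleanRows n c (rot g)).Nonempty)
    (h3 : (cleanRows n c (rot (rot g))).Nonempty) (hs : 4 ≤ sideCost n g) :
    FaceBound n c m l₁ l₂ l₃ g := by
  have a := faceCost_ge_of_three h hc hc' h1 h2 h3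
  have b := card_innerOthers_le_three (m := m) (l₁ := l₁) (l₂ := l₂) (l₃ := l₃) (g := g) hc
    (by omega)
  have d := sum_rowWidth_outer hc hc' hm hm'
  unfold FaceBound
  have e : (n - c) * (rowsWithOther n c l₁ l₂ l₃ g + rowsWithOther n c l₂ l₃ l₁ (rot g)
      + rowsWithOther n c l₃ l₁ l₂ (rot (rot g))) ≤ n * (faceCost n c g + 10 - 2 * n) :=
    Nat.mul_le_mul (Nat.sub_le n c) (by omega)
  have e' : 2 * n ≤ faceCost n c g + 10 := by omega
  replace b := b.trans (Nat.add_le_add_right (Nat.add_le_add_right e _) _)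
  generalize ∑ t ∈ Finset.Ioc (2 * c) (n - m), rowWidth n m t = S at b d
  rify [e'] at b d hs hn
  rify at e'
  generalize (faceCost n c g : ℝ) = J at *
  generalize ((innerOthers n m l₁ l₂ l₃ g).card : ℝ) = N at *
  generalize (sideCost n g : ℝ) = s at *
  have p1 : 0 ≤ (n : ℝ) * (J + 10 - 2 * n) := mul_nonneg (by linarith) (by linarith)
  have p2 : 0 ≤ (s - 4) * (n : ℝ) ^ 2 := mul_nonneg (by linarith) (by positivity)
  nlinarith

/-- Only middle rows of the third direction are controlled by the excess. The rest has area at most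
about `1/24 + 1/4 = 7/24`, so `72 · 7/24 = 21` must be covered by the `22` that two surplus side
changes contribute. -/
theorem faceBound_of_two (h : FaceLabeling n l₁ l₂ l₃ g) (hn : 100 ≤ n) (hc : 3 * c ≤ n)
    (hc' : n ≤ 3 * c + 2) (hm : 6 * m ≤ n) (hm' : n ≤ 6 * m + 5)
    (h1 : (cleanRows n c g).Nonempty) (h2 : (cleanRows n c (rot g)).Nonempty)
    (h3 : cleanRows n c (rot (rot g)) = ∅) (hs : 5 ≤ sideCost n g) :
    FaceBound n c m l₁ l₂ l₃ g := by
  have a := (faceCost_ge_of_two h hc hc' h1 h2 h3).1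
  have b := card_innerOthers_le_direction (c := c) (m := m) (l₁ := l₃) (l₂ := l₁) (l₃ := l₂)
    (g := rot (rot g)) (n := n) (by omega)
  rw [card_innerOthers_rot, card_innerOthers_rot] at b
  have d := sum_rowWidth_outer hc hc' hm hm'
  have d' := sum_rowWidth_inner hc hc' hm hm'
  unfold FaceBound
  have e : (n - c) * rowsWithOther n c l₃ l₁ l₂ (rot (rot g)) ≤ n * (faceCost n c g + 10 - 2 * n) :=
    Nat.mul_le_mul (Nat.sub_le n c) (by omega)
  have e' : 2 * n ≤ faceCost n c g + 10 := by omega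
  replace b := b.trans (Nat.add_le_add_right (Nat.add_le_add_right e _) _)
  generalize ∑ t ∈ Finset.Ioc (2 * c) (n - m), rowWidth n m t = S at b d
  generalize ∑ t ∈ Finset.range (c + 1), rowWidth n m t = S' at b d'
  rify [e'] at b d d' hs hn
  rify at e'
  generalize (faceCost n c g : ℝ) = J at *
  generalize ((innerOthers n m l₁ l₂ l₃ g).card : ℝ) = N at *
  generalize (sideCost n g : ℝ) = s at *
  have p1 : 0 ≤ (n : ℝ) * (J + 10 - 2 * n) := mul_nonneg (by linarith) (by linarith)
  have p2 : 0 ≤ (s - 5) * (n : ℝ) ^ 2 := mul_nonneg (by linarith) (by positivity)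
  nlinarith

theorem faceBound_of_two_sides (h : FaceLabeling n l₁ l₂ l₃ g) (hn : 100 ≤ n) (hc : 3 * c ≤ n)
    (hc' : n ≤ 3 * c + 2) (hm : 6 * m ≤ n) (hm' : n ≤ 6 * m + 5)
    (h1 : 0 ∈ cleanRows n c g) (h2 : 0 ∈ cleanRows n c (rot g))
    (h3 : 0 ∉ cleanRows n c (rot (rot g))) : FaceBound n c m l₁ l₂ l₃ g := by
  have hs : 4 ≤ sideCost n g := by
    have := one_le_changes_side h
    have := one_le_changes_side h.rot
    have := two_le_changes_side h3
    unfold sideCost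
    omega
  rcases (cleanRows n c (rot (rot g))).eq_empty_or_nonempty with h3' | h3'
  swap
  · exact faceBound_of_three h hn hc hc' hm hm' ⟨0, h1⟩ ⟨0, h2⟩ h3' hs
  obtain ⟨a', a⟩ := faceCost_ge_of_two h hc hc' ⟨0, h1⟩ ⟨0, h2⟩ h3'
  have e' : 2 * n ≤ faceCost n c g + 10 := by omega
  unfold FaceBound
  rcases a h1 h2 with a | a
  · have b := card_innerOthers_le_clean (m := m) h hc (by omega)
    have k1 := card_cleanRows_le n c g
    have k2 := card_cleanRows_le n c (rot g)
    have e : (n + 1) * (c + 1 - (cleanRows n c g).card) +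
        (n + 1) * (c + 1 - (cleanRows n c (rot g)).card)
        ≤ (n + 1) * (faceCost n c g + 10 - 2 * n + 2) := by
      rw [← mul_add]
      exact Nat.mul_le_mul le_rfl (by omega)
    replace b := b.trans (Nat.add_le_add_right e _)
    have f : 3 * (n - 2 * c) ≤ n + 4 := by omega
    have f' := Nat.mul_le_mul f f
    generalize n - 2 * c = q at *
    rify [e'] at b hs hn f'
    rify at e'
    generalize (faceCost n c g : ℝ) = J at *
    generalize ((innerOthers n m l₁ l₂ l₃ g).card : ℝ) = N at *
    generalize (sideCost n g : ℝ) = s at *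
    have p1 : 0 ≤ ((n : ℝ) - 100) * (J + 10 - 2 * n) := mul_nonneg (by linarith) (by linarith)
    have p2 : 0 ≤ (s - 4) * (n : ℝ) ^ 2 := mul_nonneg (by linarith) (by positivity)
    have p3 : 0 ≤ ((n : ℝ) - 100) * n := mul_nonneg (by linarith) (by linarith)
    nlinarith
  · have b := card_innerOthers_le_three (m := m) (l₁ := l₁) (l₂ := l₂) (l₃ := l₃) (g := g) hc
      (by omega)
    have d := sum_rowWidth_outer hc hc' hm hm'
    have e : (n - c) * (rowsWithOther n c l₁ l₂ l₃ g + rowsWithOther n c l₂ l₃ l₁ (rot g)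
        + rowsWithOther n c l₃ l₁ l₂ (rot (rot g))) ≤ n * (5 * (faceCost n c g + 10 - 2 * n)) :=
      Nat.mul_le_mul (Nat.sub_le n c) (by omega)
    replace b := b.trans (Nat.add_le_add_right (Nat.add_le_add_right e _) _)
    generalize ∑ t ∈ Finset.Ioc (2 * c) (n - m), rowWidth n m t = S at b d
    rify [e'] at b d hs hn
    rify at e'
    generalize (faceCost n c g : ℝ) = J at *
    generalize ((innerOthers n m l₁ l₂ l₃ g).card : ℝ) = N at *
    generalize (sideCost n g : ℝ) = s at *
    have p1 : 0 ≤ (n : ℝ) * (J + 10 - 2 * n) := mul_nonneg (by linarith) (by linarith)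
    have p2 : 0 ≤ (s - 4) * (n : ℝ) ^ 2 := mul_nonneg (by linarith) (by positivity)
    nlinarith

theorem faceBound_of_one_side (h : FaceLabeling n l₁ l₂ l₃ g) (hn : 100 ≤ n) (hc : 3 * c ≤ n)
    (hc' : n ≤ 3 * c + 2) (hm : 6 * m ≤ n) (hm' : n ≤ 6 * m + 5)
    (h1 : 0 ∈ cleanRows n c g) (h2 : 0 ∉ cleanRows n c (rot g))
    (h3 : 0 ∉ cleanRows n c (rot (rot g))) : FaceBound n c m l₁ l₂ l₃ g := by
  have hs : 5 ≤ sideCost n g := by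
    have := one_le_changes_side h
    have := two_le_changes_side h2
    have := two_le_changes_side h3
    unfold sideCost
    omega
  rcases (cleanRows n c (rot g)).eq_empty_or_nonempty with h2' | h2' <;>
  rcases (cleanRows n c (rot (rot g))).eq_empty_or_nonempty with h3' | h3'
  · have a := faceCost_ge_of_side h hc hc' h1 h2' h3'
    have b := (card_innerOthers_le (m := m) (l₁ := l₁) (l₂ := l₂) (l₃ := l₃) (g := g) (n := n)
      (by omega))
    have d := sum_rowWidth_all hm hm'
    have e : n ≤ 9 * (faceCost n c g + 10 - 2 * n) + 40 := by omega
    have e' : 2 * n ≤ faceCost n c g + 10 := by omega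
    generalize ∑ t ∈ Finset.range (n - m + 1), rowWidth n m t = S at b d
    unfold FaceBound
    rify [e'] at b d e hs hn
    rify at e'
    generalize (faceCost n c g : ℝ) = J at *
    generalize ((innerOthers n m l₁ l₂ l₃ g).card : ℝ) = N at *
    generalize (sideCost n g : ℝ) = s at *
    have p1 : 0 ≤ (n : ℝ) * (9 * (J + 10 - 2 * n) + 40 - n) :=
      mul_nonneg (by linarith) (by linarith)
    have p2 : 0 ≤ (s - 5) * (n : ℝ) ^ 2 := mul_nonneg (by linarith) (by positivity)
    nlinarith
  · exact faceBound_rot (faceBound_rot (faceBound_of_two h.rot.rot hn hc hc' hm hm' h3' ⟨0, h1⟩ h2'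
      (by rwa [sideCost_rot, sideCost_rot])))
  · exact faceBound_of_two h hn hc hc' hm hm' ⟨0, h1⟩ h2' h3' hs
  · exact faceBound_of_three h hn hc hc' hm hm' ⟨0, h1⟩ h2' h3' (by omega)

/-- This case determines the coefficient `11`: three surplus side changes must pay for all points
outside the corners, and `72 · 11/24 = 11 · 3`. -/
theorem faceBound_of_no_side (h : FaceLabeling n l₁ l₂ l₃ g) (hn : 100 ≤ n) (hc : 3 * c ≤ n)
    (hc' : n ≤ 3 * c + 2) (hm : 6 * m ≤ n) (hm' : n ≤ 6 * m + 5)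
    (h1 : 0 ∉ cleanRows n c g) (h2 : 0 ∉ cleanRows n c (rot g))
    (h3 : 0 ∉ cleanRows n c (rot (rot g))) : FaceBound n c m l₁ l₂ l₃ g := by
  have hs : 6 ≤ sideCost n g := by
    have := two_le_changes_side h1
    have := two_le_changes_side h2
    have := two_le_changes_side h3
    unfold sideCost
    omega
  have e' := le_faceCost h hc hc'
  have b := (card_innerOthers_le (m := m) (l₁ := l₁) (l₂ := l₂) (l₃ := l₃) (g := g) (n := n)
    (by omega))
  have d := sum_rowWidth_all hm hm'
  generalize ∑ t ∈ Finset.range (n - m + 1), rowWidth n m t = S at b d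
  unfold FaceBound
  rify at b d e' hs hn
  generalize (faceCost n c g : ℝ) = J at *
  generalize ((innerOthers n m l₁ l₂ l₃ g).card : ℝ) = N at *
  generalize (sideCost n g : ℝ) = s at *
  have p1 : 0 ≤ (n : ℝ) * (J + 10 - 2 * n) := mul_nonneg (by linarith) (by linarith)
  have p2 : 0 ≤ (s - 6) * (n : ℝ) ^ 2 := mul_nonneg (by linarith) (by positivity)
  nlinarith

/-- The sides need not contribute any surplus here, so the excess must pay for every point with an
additional label; `faceCost_ge_of_clean_sides` charges each row containing one. -/
theorem faceBound_of_three_sides (h : FaceLabeling n l₁ l₂ l₃ g) (hn : 100 ≤ n) (hc : 3 * c ≤ n)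
    (hc' : n ≤ 3 * c + 2) (hm : 6 * m ≤ n)
    (h1 : 0 ∈ cleanRows n c g) (h2 : 0 ∈ cleanRows n c (rot g))
    (h3 : 0 ∈ cleanRows n c (rot (rot g))) : FaceBound n c m l₁ l₂ l₃ g := by
  have hs : 3 ≤ sideCost n g := by
    have := one_le_changes_side h
    have := one_le_changes_side h.rot
    have := one_le_changes_side h.rot.rot
    unfold sideCost
    omega
  have a := faceCost_ge_of_clean_sides h hc hc' h1 h2 h3
  have e' := le_faceCost h hc hc'
  have b := card_innerOthers_le_allRows (m := m) (l₁ := l₁) (l₂ := l₂) (l₃ := l₃) (g := g) hc hc'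
    (by omega) (by omega)
  have e : (n + 1) * (allRowsWithOther n c l₁ l₂ l₃ g + allRowsWithOther n c l₂ l₃ l₁ (rot g))
      ≤ (n + 1) * (3 * (faceCost n c g + 10 - 2 * n)) := Nat.mul_le_mul le_rfl (by omega)
  replace b := b.trans e
  unfold FaceBound
  rify [e'] at b hs hn
  rify at e'
  generalize (faceCost n c g : ℝ) = J at *
  generalize ((innerOthers n m l₁ l₂ l₃ g).card : ℝ) = N at *
  generalize (sideCost n g : ℝ) = s at *
  have p1 : 0 ≤ ((n : ℝ) - 100) * (J + 10 - 2 * n) := mul_nonneg (by linarith) (by linarith)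
  have p2 : 0 ≤ (s - 3) * (n : ℝ) ^ 2 := mul_nonneg (by linarith) (by positivity)
  nlinarith

theorem faceBound (h : FaceLabeling n l₁ l₂ l₃ g) (hn : 100 ≤ n) (hc : 3 * c ≤ n)
    (hc' : n ≤ 3 * c + 2) (hm : 6 * m ≤ n) (hm' : n ≤ 6 * m + 5) : FaceBound n c m l₁ l₂ l₃ g := by
  by_cases h1 : 0 ∈ cleanRows n c g <;> by_cases h2 : 0 ∈ cleanRows n c (rot g) <;>
    by_cases h3 : 0 ∈ cleanRows n c (rot (rot g))
  · exact faceBound_of_three_sides h hn hc hc' hm h1 h2 h3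
  · exact faceBound_of_two_sides h hn hc hc' hm hm' h1 h2 h3
  · exact faceBound_rot (faceBound_rot (faceBound_of_two_sides h.rot.rot hn hc hc' hm hm' h3 h1 h2))
  · exact faceBound_of_one_side h hn hc hc' hm hm' h1 h2 h3
  · exact faceBound_rot (faceBound_of_two_sides h.rot hn hc hc' hm hm' h2 h3 h1)
  · exact faceBound_rot (faceBound_of_one_side h.rot hn hc hc' hm hm' h2 h3 h1)
  · exact faceBound_rot (faceBound_rot (faceBound_of_one_side h.rot.rot hn hc hc' hm hm' h3 h1 h2))
  · exact faceBound_of_no_side h hn hc hc' hm hm' h1 h2 h3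

end FaceInequality

/-! ### The corners of a triangle. -/

section Corner

variable {Λ : Type*} [DecidableEq Λ] {n m : ℕ} {l₁ l₂ l₃ : Λ} {g : ℕ → ℕ → ℕ → Λ}

/-- The lattice path from the first vertex of the triangle to the point `(n - l, b, l - b)`. -/
def cornerPath (g : ℕ → ℕ → ℕ → Λ) (n b i : ℕ) : Λ := g (n - i) (min i b) (i - b)

/-- The changes along all paths from the first vertex to the points at distance less than `m`. -/
def vertexCost (n m : ℕ) (g : ℕ → ℕ → ℕ → Λ) : ℕ :=
  ∑ l ∈ Finset.range m, ∑ b ∈ Finset.range (l + 1), changes (cornerPath g n b) l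

/-- The changes along the paths in the three corners of the triangle. -/
def cornerCost (n m : ℕ) (g : ℕ → ℕ → ℕ → Λ) : ℕ :=
  vertexCost n m g + vertexCost n m (rot g) + vertexCost n m (rot (rot g))

/-- Each point in the corner is the end of its own path from the vertex, and that path changes if
the point does not have the label of the vertex. -/
theorem card_le_vertexCost (S : Finset (ℕ × ℕ × ℕ)) (hv : g n 0 0 = l₁)
    (hS : ∀ p ∈ S, p.1 + p.2.1 + p.2.2 = n ∧ n - m < p.1 ∧ g p.1 p.2.1 p.2.2 ≠ l₁) :
    S.card ≤ vertexCost n m g := by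
  have h1 : S.card ≤ ∑ l ∈ Finset.range m,
      ((Finset.range (l + 1)).filter fun b => g (n - l) b (l - b) ≠ l₁).card := by
    refine card_le_sum_card S (fun p => n - p.1) (fun p => p.2.1) _ _ ?_ ?_
    · rintro ⟨a, b, d⟩ hp
      obtain ⟨e1, e2, e3⟩ := hS _ hp
      dsimp only at *
      rw [Finset.mem_range, Finset.mem_filter, Finset.mem_range]
      refine ⟨by omega, by omega, ?_⟩
      rwa [show n - (n - a) = a by omega, show n - a - b = d by omega]
    · rintro ⟨a, b, d⟩ hp ⟨a', b', d'⟩ hp' e e'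
      obtain ⟨e1, -, -⟩ := hS _ hp
      obtain ⟨e2, -, -⟩ := hS _ hp'
      dsimp only at *
      obtain rfl : a = a' := by omega
      obtain rfl : b = b' := by omega
      obtain rfl : d = d' := by omega
      rfl
  refine h1.trans (Finset.sum_le_sum fun l _ => ?_)
  rw [Finset.card_filter]
  refine Finset.sum_le_sum fun b hb => ?_
  rw [Finset.mem_range] at hb
  split_ifs with h
  · refine one_le_changes (i := l) (j := 0) le_rfl (Nat.zero_le l) ?_
    unfold cornerPath
    rw [show min l b = b by omega, show min 0 b = 0 by omega, Nat.zero_sub, Nat.sub_zero, hv]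
    exact h
  · exact Nat.zero_le _

theorem card_innerOthers_zero_le (h : FaceLabeling n l₁ l₂ l₃ g) :
    (innerOthers n 0 l₁ l₂ l₃ g).card ≤ (innerOthers n m l₁ l₂ l₃ g).card + cornerCost n m g := by
  have hu : innerOthers n 0 l₁ l₂ l₃ g ⊆ innerOthers n m l₁ l₂ l₃ g ∪
      (((innerOthers n 0 l₁ l₂ l₃ g).filter fun p => n - m < p.1) ∪
      (((innerOthers n 0 l₁ l₂ l₃ g).filter fun p => n - m < p.2.1) ∪
      ((innerOthers n 0 l₁ l₂ l₃ g).filter fun p => n - m < p.2.2))) := by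
    rintro ⟨a, b, d⟩ hp
    simp only [Finset.mem_union, Finset.mem_filter, mem_innerOthers] at hp ⊢
    by_cases h1 : n - m < a
    · tauto
    by_cases h2 : n - m < b
    · tauto
    by_cases h3 : n - m < d
    · tauto
    exact Or.inl ⟨hp.1, by omega, hp.2.2⟩
  have k1 := card_le_vertexCost (m := m)
    ((innerOthers n 0 l₁ l₂ l₃ g).filter fun p => n - m < p.1) h.v1 (by
      rintro ⟨a, b, d⟩ hp
      rw [Finset.mem_filter, mem_innerOthers] at hp
      exact ⟨hp.1.1, hp.2, hp.1.2.2.1⟩)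
  have k2 := card_le_vertexCost (m := m) (((innerOthers n 0 l₁ l₂ l₃ g).filter
    fun p => n - m < p.2.1).image fun p => (p.2.1, p.2.2, p.1)) h.rot.v1 (by
      intro q hq
      obtain ⟨⟨a, b, d⟩, hp, rfl⟩ := Finset.mem_image.1 hq
      rw [Finset.mem_filter, mem_innerOthers] at hp
      exact ⟨by dsimp only at *; omega, hp.2, hp.1.2.2.2.1⟩)
  have k3 := card_le_vertexCost (m := m) (((innerOthers n 0 l₁ l₂ l₃ g).filter
    fun p => n - m < p.2.2).image fun p => (p.2.2, p.1, p.2.1)) h.rot.rot.v1 (by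
      intro q hq
      obtain ⟨⟨a, b, d⟩, hp, rfl⟩ := Finset.mem_image.1 hq
      rw [Finset.mem_filter, mem_innerOthers] at hp
      exact ⟨by dsimp only at *; omega, hp.2, hp.1.2.2.2.2⟩)
  rw [Finset.card_image_of_injective _ (by
    rintro ⟨a, b, d⟩ ⟨a', b', d'⟩ e
    simp only [Prod.mk.injEq] at e ⊢
    tauto)] at k2 k3
  have := (Finset.card_le_card hu).trans ((Finset.card_union_le _ _).trans
    (Nat.add_le_add_left ((Finset.card_union_le _ _).trans
      (Nat.add_le_add_left (Finset.card_union_le _ _) _)) _))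
  unfold cornerCost
  omega

end Corner

/-! ### Monochromatic simplices in a labelled tetrahedron. -/

section Tetrahedron

variable {n N : ℕ} {f : (Fin 4 → ℕ) → Fin 5}

/-- The grid points of the tetrahedron with coordinate sum `N`. -/
def tetraGrid (N : ℕ) : Finset (Fin 4 → ℕ) := Finset.piAntidiag Finset.univ N

theorem mem_tetraGrid {x : Fin 4 → ℕ} : x ∈ tetraGrid N ↔ ∑ i, x i = N := by
  simp [tetraGrid, Finset.mem_piAntidiag]

theorem six_mul_card_tetraGrid (N : ℕ) :
    6 * (tetraGrid N).card = (N + 1) * (N + 2) * (N + 3) := by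
  have h : (tetraGrid N).card = (N + 3).choose 3 := by
    have h1 : (tetraGrid N).card = (Finset.finsuppAntidiag (Finset.univ : Finset (Fin 4)) N).card := by
      simp [tetraGrid, Finset.finsuppAntidiag]
    rw [h1, Finset.card_finsuppAntidiag_nat_eq_choose, Finset.card_univ, Fintype.card_fin,
      show 4 + N - 1 = N + 3 by omega, ← Nat.choose_symm_add]
  rw [h]
  have := Nat.ascFactorial_eq_factorial_mul_choose N 3
  simp only [Nat.ascFactorial, Nat.factorial] at this
  linarith

/-- A labelling of the grid points with coordinate sum `n` of the tetrahedron, where the vertex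
with index `i` has the label `i.castSucc`, which does not occur on the opposite face. -/
structure TetraLabeling (n : ℕ) (f : (Fin 4 → ℕ) → Fin 5) : Prop where
  vertex : ∀ i, f (Pi.single i n) = i.castSucc
  support : ∀ x i, ∑ j, x j = n → f x = i.castSucc → x i ≠ 0

/-- The restriction of a labelling of the tetrahedron to the face opposite to the vertex `i`. -/
def face (i : Fin 4) (f : (Fin 4 → ℕ) → Fin 5) (a b d : ℕ) : Fin 5 := f (i.insertNth 0 ![a, b, d])

theorem sum_insertNth (i : Fin 4) (a b d : ℕ) :
    ∑ j, (i.insertNth 0 ![a, b, d] : Fin 4 → ℕ) j = a + b + d := by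
  rw [Fin.sum_univ_succAbove _ i]
  simp [Fin.sum_univ_three]

theorem TetraLabeling.faceLabeling (h : TetraLabeling n f) (i : Fin 4) :
    FaceLabeling n (i.succAbove 0).castSucc (i.succAbove 1).castSucc (i.succAbove 2).castSucc
      (face i f) := by
  have hne : ∀ j k : Fin 3, j ≠ k → (i.succAbove j).castSucc ≠ (i.succAbove k).castSucc := by
    intro j k hjk e
    exact hjk (Fin.succAbove_right_injective (Fin.castSucc_injective _ e))
  have hv : ∀ (k : Fin 3) (a b d : ℕ), ![a, b, d] = Pi.single k n →
      face i f a b d = (i.succAbove k).castSucc := by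
    intro k a b d e
    rw [← h.vertex]
    unfold face
    congr 1
    rw [e]
    refine Fin.insertNth_eq_iff.2 ⟨?_, ?_⟩
    · rw [Pi.single_eq_of_ne (Fin.succAbove_ne i k).symm]
    · ext j
      simp only [Fin.removeNth]
      by_cases hj : j = k
      · subst hj; simp
      · rw [Pi.single_eq_of_ne hj, Pi.single_eq_of_ne]
        exact fun e => hj (Fin.succAbove_right_injective e)
  have hs : ∀ (k : Fin 3) (a b d : ℕ), a + b + d = n → ![a, b, d] k = 0 →
      face i f a b d ≠ (i.succAbove k).castSucc := by
    intro k a b d e hk he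
    refine h.support _ _ ?_ he ?_
    · rw [sum_insertNth, e]
    · simpa using hk
  exact
    { ne12 := hne _ _ (by decide)
      ne13 := hne _ _ (by decide)
      ne23 := hne _ _ (by decide)
      v1 := hv 0 _ _ _ (by ext j; fin_cases j <;> simp)
      v2 := hv 1 _ _ _ (by ext j; fin_cases j <;> simp)
      v3 := hv 2 _ _ _ (by ext j; fin_cases j <;> simp)
      s1 := fun b d e => hs 0 _ _ _ (by omega) rfl
      s2 := fun a d e => hs 1 _ _ _ (by omega) rfl
      s3 := fun a b e => hs 2 _ _ _ (by omega) rfl }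

/-- Twice the number of edges with different labels in the upward simplices of the grid. -/
def simplexCost (N : ℕ) (f : (Fin 4 → ℕ) → Fin 5) : ℕ :=
  ∑ x ∈ tetraGrid N, ∑ i, ∑ j, if f (x + Pi.single i 1) ≠ f (x + Pi.single j 1) then 1 else 0

/-- A nontrivial partition of four points separates at least three pairs, with equality for one
point against three; ordered pairs double this. -/
theorem six_le_of_nonconstant {Λ : Type*} [DecidableEq Λ] (h : Fin 4 → Λ) (k : Fin 4)
    (hk : h 0 ≠ h k) : 6 ≤ ∑ i, ∑ j, if h i ≠ h j then 1 else 0 := by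
  have hk' : h 0 ≠ h 1 ∨ h 0 ≠ h 2 ∨ h 0 ≠ h 3 := by
    fin_cases k
    · exact absurd rfl hk
    · exact Or.inl hk
    · exact Or.inr (Or.inl hk)
    · exact Or.inr (Or.inr hk)
  have hs : ∀ i j, (if h i ≠ h j then 1 else 0) = if h j ≠ h i then 1 else 0 := fun i j => by
    simp only [ne_comm]
  simp only [Fin.sum_univ_four]
  rw [hs 1 0, hs 2 0, hs 3 0, hs 2 1, hs 3 1, hs 3 2]
  by_cases h1 : h 0 = h 1 <;> by_cases h2 : h 0 = h 2 <;> by_cases h3 : h 0 = h 3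
  · tauto
  all_goals
    by_cases h4 : h 1 = h 2 <;> by_cases h5 : h 1 = h 3 <;> by_cases h6 : h 2 = h 3 <;>
    simp_all

theorem sum_add_single (x : Fin 4 → ℕ) (i : Fin 4) :
    ∑ j, (x + Pi.single i 1 : Fin 4 → ℕ) j = ∑ j, x j + 1 := by
  simp [Finset.sum_add_distrib]

theorem sub_single_add_single {x : Fin 4 → ℕ} {k : Fin 4} (h : x k ≠ 0) :
    x - Pi.single k 1 + Pi.single k 1 = x := by
  ext j
  by_cases hj : j = k
  · subst hj
    simp only [Pi.add_apply, Pi.sub_apply, Pi.single_eq_same]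
    omega
  · simp [Pi.single_eq_of_ne hj]

/-- The direction in which a monochromatic simplex is moved: the vertex of its label, or `i₀` if the
label is the additional one. -/
def shiftIndex (i₀ : Fin 4) (c : Fin 5) : Fin 4 := if h : (c : ℕ) < 4 then ⟨c, h⟩ else i₀

theorem castSucc_shiftIndex (i₀ : Fin 4) {c : Fin 5} (hc : c ≠ Fin.last 4) :
    (shiftIndex i₀ c).castSucc = c := by
  have h : (c : ℕ) < 4 := by
    have := Fin.val_lt_last hc
    simpa using this
  unfold shiftIndex
  rw [dif_pos h]
  rfl

/-- The number of monochromatic simplices exceeds the number of simplices of the next smaller grid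
by at most the number of points with the additional label on a face. -/
theorem card_monochromatic_le (h : TetraLabeling (N + 2) f) (i₀ : Fin 4) :
    ((tetraGrid (N + 1)).filter fun x => ∀ k, f (x + Pi.single 0 1) = f (x + Pi.single k 1)).card ≤
      (tetraGrid N).card + (innerOthers (N + 2) 0 (i₀.succAbove 0).castSucc
        (i₀.succAbove 1).castSucc (i₀.succAbove 2).castSucc (face i₀ f)).card := by
  set A := (tetraGrid (N + 1)).filter fun x => ∀ k, f (x + Pi.single 0 1) = f (x + Pi.single k 1)
  rw [← Finset.card_filter_add_card_filter_not (s := A)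
    fun x => f (x + Pi.single 0 1) ≠ Fin.last 4 ∨ x i₀ ≠ 0]
  -- For a vertex label `k`, a corner `x + e_j` with `j ≠ k` also has label `k`, so its `k`-th
  -- coordinate, which is that of `x`, is nonzero and `x` can be moved by `-e_k`.
  have key : ∀ x ∈ A, f (x + Pi.single 0 1) ≠ Fin.last 4 ∨ x i₀ ≠ 0 →
      x (shiftIndex i₀ (f (x + Pi.single 0 1))) ≠ 0 := by
    intro x hx hx'
    obtain ⟨h1, h2⟩ := Finset.mem_filter.1 hx
    rw [mem_tetraGrid] at h1
    by_cases hl : f (x + Pi.single 0 1) = Fin.last 4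
    · rw [hl]
      have : shiftIndex i₀ (Fin.last 4) = i₀ := by simp [shiftIndex]
      rw [this]
      tauto
    · have e := castSucc_shiftIndex i₀ hl
      set k := shiftIndex i₀ (f (x + Pi.single 0 1))
      obtain ⟨j, hj⟩ := exists_ne k
      rw [h2 j] at e
      have := h.support _ _ (by rw [sum_add_single, h1]) e.symm
      rwa [Pi.add_apply, Pi.single_eq_of_ne hj.symm, add_zero] at this
  refine add_le_add ?_ ?_
  · refine Finset.card_le_card_of_injOn
      (fun x => x - Pi.single (shiftIndex i₀ (f (x + Pi.single 0 1))) 1) ?_ ?_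
    · intro x hx
      obtain ⟨h1, h2⟩ := Finset.mem_filter.1 hx
      have h3 := key x h1 h2
      have h4 := mem_tetraGrid.1 (Finset.mem_filter.1 h1).1
      refine mem_tetraGrid.2 ?_
      dsimp only
      generalize shiftIndex i₀ (f (x + Pi.single 0 1)) = k at *
      have h5 : x - Pi.single k 1 + Pi.single k 1 = x := sub_single_add_single h3
      have h6 := sum_add_single (x - Pi.single k 1) k
      rw [h5] at h6
      omega
    · intro x hx y hy e
      obtain ⟨hx1, hx2⟩ := Finset.mem_filter.1 hx
      obtain ⟨hy1, hy2⟩ := Finset.mem_filter.1 hy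
      have hx3 := key x hx1 hx2
      have hy3 := key y hy1 hy2
      have hx4 := (Finset.mem_filter.1 hx1).2
      have hy4 := (Finset.mem_filter.1 hy1).2
      dsimp only at e
      set k := shiftIndex i₀ (f (x + Pi.single 0 1)) with hk
      set l := shiftIndex i₀ (f (y + Pi.single 0 1)) with hl
      have ex : x - Pi.single k 1 + Pi.single k 1 = x := sub_single_add_single hx3
      have ey : y - Pi.single l 1 + Pi.single l 1 = y := sub_single_add_single hy3
      -- Two simplices moved to the same place share a corner. Both are monochromatic, hence have
      -- the same label and were moved in the same direction.
      have exy : x + Pi.single l 1 = y + Pi.single k 1 := by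
        conv_lhs => rw [← ex, e]
        conv_rhs => rw [← ey]
        exact add_right_comm _ _ _
      have hkl : k = l := by
        rw [hk, hl, hx4 l, hy4 k, exy]
      rw [← ex, e, hkl, ey]
  -- The simplices that cannot be moved have the fifth label and `x i₀ = 0`; their corner in any
  -- fixed direction `j ≠ i₀` is a point of the face with that label.
  · obtain ⟨j, hj⟩ := exists_ne i₀
    refine Finset.card_le_card_of_injOn (fun x =>
      ((x + Pi.single j 1 : Fin 4 → ℕ) (i₀.succAbove 0),
        (x + Pi.single j 1 : Fin 4 → ℕ) (i₀.succAbove 1),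
        (x + Pi.single j 1 : Fin 4 → ℕ) (i₀.succAbove 2))) ?_ ?_
    · intro x hx
      obtain ⟨h1, h2⟩ := Finset.mem_filter.1 hx
      push Not at h2
      have h3 := mem_tetraGrid.1 (Finset.mem_filter.1 h1).1
      have h4 := (Finset.mem_filter.1 h1).2
      have h5 : f (x + Pi.single j 1) = Fin.last 4 := (h4 j).symm.trans h2.1
      have h6 : (x + Pi.single j 1 : Fin 4 → ℕ) i₀ = 0 := by
        rw [Pi.add_apply, h2.2, Pi.single_eq_of_ne hj.symm, add_zero]
      have h7 := sum_add_single x j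
      dsimp only
      generalize (x + Pi.single j 1 : Fin 4 → ℕ) = y at *
      have h8 : face i₀ f (y (i₀.succAbove 0)) (y (i₀.succAbove 1)) (y (i₀.succAbove 2))
          = Fin.last 4 := by
        rw [← h5]
        unfold face
        congr 1
        refine Fin.insertNth_eq_iff.2 ⟨h6.symm, ?_⟩
        ext k
        fin_cases k <;> rfl
      rw [Fin.sum_univ_succAbove _ i₀, h6, Fin.sum_univ_three] at h7
      refine Finset.mem_coe.2 (mem_innerOthers.2 ⟨by omega, by omega, ?_⟩)
      rw [h8]
      exact ⟨(Fin.castSucc_lt_last _).ne', (Fin.castSucc_lt_last _).ne',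
        (Fin.castSucc_lt_last _).ne'⟩
    · intro x hx y hy e
      have hx2 := (Finset.mem_filter.1 hx).2
      have hy2 := (Finset.mem_filter.1 hy).2
      push Not at hx2 hy2
      simp only [Prod.mk.injEq, Pi.add_apply, add_left_inj] at e
      ext k
      rcases Fin.eq_self_or_eq_succAbove i₀ k with rfl | ⟨k, rfl⟩
      · rw [hx2.2, hy2.2]
      · fin_cases k
        exacts [e.1, e.2.1, e.2.2]

/-- The main term is six times the difference of two consecutive tetrahedral numbers, since every
simplex that is not monochromatic contributes at least six. -/
theorem simplexCost_ge (h : TetraLabeling (N + 2) f) (i₀ : Fin 4) :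
    3 * ((N + 2) * (N + 3)) ≤ simplexCost (N + 1) f + 6 * (innerOthers (N + 2) 0
      (i₀.succAbove 0).castSucc (i₀.succAbove 1).castSucc (i₀.succAbove 2).castSucc
        (face i₀ f)).card := by
  have h1 := card_monochromatic_le h i₀
  have h2 : 6 * ((tetraGrid (N + 1)).filter
      fun x => ¬ ∀ k, f (x + Pi.single 0 1) = f (x + Pi.single k 1)).card ≤
        simplexCost (N + 1) f := by
    unfold simplexCost
    rw [Finset.card_filter, Finset.mul_sum]
    refine Finset.sum_le_sum fun x _ => ?_
    split_ifs with hx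
    · exact Nat.zero_le _
    · push Not at hx
      obtain ⟨k, hk⟩ := hx
      exact six_le_of_nonconstant (fun i => f (x + Pi.single i 1)) k hk
  have h3 := Finset.card_filter_add_card_filter_not (s := tetraGrid (N + 1))
    fun x => ∀ k, f (x + Pi.single 0 1) = f (x + Pi.single k 1)
  have h4 := six_mul_card_tetraGrid N
  have h5 := six_mul_card_tetraGrid (N + 1)
  nlinarith

end Tetrahedron

/-! ### Expected costs as path length times `κ`. -/

section MeanBound

variable {Ω : Type*} [MeasurableSpace Ω] {μ : Measure Ω} {κ : ℝ}

/-- The random variable `F` is integrable, with expectation at most `L * κ`. -/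
def MeanAtMost (μ : Measure Ω) (κ : ℝ) (F : Ω → ℝ) (L : ℝ) : Prop :=
  Integrable F μ ∧ ∫ ω, F ω ∂μ ≤ L * κ

theorem MeanAtMost.add {F G : Ω → ℝ} {L M : ℝ} (hF : MeanAtMost μ κ F L)
    (hG : MeanAtMost μ κ G M) : MeanAtMost μ κ (fun ω => F ω + G ω) (L + M) := by
  refine ⟨hF.1.add hG.1, ?_⟩
  rw [integral_add hF.1 hG.1, add_mul]
  exact add_le_add hF.2 hG.2

theorem MeanAtMost.sum {ι : Type*} {s : Finset ι} {F : ι → Ω → ℝ} {L : ι → ℝ}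
    (h : ∀ i ∈ s, MeanAtMost μ κ (F i) (L i)) :
    MeanAtMost μ κ (fun ω => ∑ i ∈ s, F i ω) (∑ i ∈ s, L i) := by
  refine ⟨integrable_finsetSum _ fun i hi => (h i hi).1, ?_⟩
  rw [integral_finsetSum _ fun i hi => (h i hi).1, Finset.sum_mul]
  exact Finset.sum_le_sum fun i hi => (h i hi).2

theorem MeanAtMost.const_mul {F : Ω → ℝ} {L r : ℝ} (h : MeanAtMost μ κ F L) (hr : 0 ≤ r) :
    MeanAtMost μ κ (fun ω => r * F ω) (r * L) := by
  refine ⟨h.1.const_mul r, ?_⟩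
  rw [integral_const_mul, mul_assoc]
  exact mul_le_mul_of_nonneg_left h.2 hr

theorem MeanAtMost.mono {F : Ω → ℝ} {L M : ℝ} (h : MeanAtMost μ κ F L) (hκ : 0 ≤ κ)
    (hLM : L ≤ M) : MeanAtMost μ κ F M :=
  ⟨h.1, h.2.trans (mul_le_mul_of_nonneg_right hLM hκ)⟩

variable {Λ : Type*} [DecidableEq Λ] {n : ℕ} {g : Ω → ℕ → ℕ → ℕ → Λ}

/-- Adjacent points of a randomly labelled triangle have different labels with probability at
most `κ`. -/
def EdgeBound (μ : Measure Ω) (κ : ℝ) (n : ℕ) (g : Ω → ℕ → ℕ → ℕ → Λ) : Prop :=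
  ∀ a b d a' b' d', a + b + d = n → a' + b' + d' = n →
    a ≤ a' + 1 → a' ≤ a + 1 → b ≤ b' + 1 → b' ≤ b + 1 → d ≤ d' + 1 → d' ≤ d + 1 →
      MeanAtMost μ κ (fun ω => if g ω a b d ≠ g ω a' b' d' then 1 else 0) 1

theorem EdgeBound.rot (h : EdgeBound μ κ n g) : EdgeBound μ κ n fun ω => rot (g ω) := by
  intro a b d a' b' d' h1 h2 h3 h4 h5 h6 h7 h8
  exact h d a b d' a' b' (by omega) (by omega) h7 h8 h3 h4 h5 h6

theorem meanAtMost_changes {p : Ω → ℕ → Λ} {N : ℕ}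
    (h : ∀ i < N, MeanAtMost μ κ (fun ω => if p ω i ≠ p ω (i + 1) then 1 else 0) 1) :
    MeanAtMost μ κ (fun ω => (changes (p ω) N : ℝ)) N := by
  have := MeanAtMost.sum (s := Finset.range N) fun i hi => h i (Finset.mem_range.1 hi)
  simp only [changes_eq_sum]
  push_cast
  simpa using this

theorem EdgeBound.changes_extRow (h : EdgeBound μ κ n g) {j : ℕ} (hj : j ≤ n) :
    MeanAtMost μ κ (fun ω => (changes (extRow (g ω) n j) (n + j) : ℝ)) (n + j : ℕ) := by
  refine meanAtMost_changes fun i hi => ?_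
  unfold extRow
  apply h <;> omega

theorem EdgeBound.changes_row (h : EdgeBound μ κ n g) {t : ℕ} (ht : t ≤ n) :
    MeanAtMost μ κ (fun ω => (changes (row (g ω) n t) (n - t) : ℝ)) (n - t : ℕ) := by
  refine meanAtMost_changes fun i hi => ?_
  unfold row
  apply h <;> omega

theorem EdgeBound.changes_cornerPath (h : EdgeBound μ κ n g) {b l : ℕ} (hb : b ≤ l) (hl : l ≤ n) :
    MeanAtMost μ κ (fun ω => (changes (cornerPath (g ω) n b) l : ℝ)) l := by
  refine meanAtMost_changes fun i hi => ?_
  unfold cornerPath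
  apply h <;> omega

theorem EdgeBound.sideCost (h : EdgeBound μ κ n g) :
    MeanAtMost μ κ (fun ω => (sideCost n (g ω) : ℝ)) (3 * n) := by
  have h1 := h.changes_extRow (Nat.zero_le n)
  have h2 := h.rot.changes_extRow (Nat.zero_le n)
  have h3 := h.rot.rot.changes_extRow (Nat.zero_le n)
  rw [add_zero] at h1 h2 h3
  have := (h1.add h2).add h3
  unfold _root_.sideCost
  push_cast
  convert this using 1
  ring

theorem sum_length_extRow (n c : ℕ) :
    2 * ∑ j ∈ Finset.range (c + 1), (n + j) = (c + 1) * (2 * n + c) := by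
  induction c with
  | zero => simp
  | succ c ih =>
    rw [Finset.sum_range_succ, mul_add, ih]
    ring

theorem sum_length_row (n c d : ℕ) (h : c + d ≤ n) :
    2 * ∑ t ∈ Finset.Ioc c (c + d), (n - t) + d * (2 * c + d + 1) = 2 * d * n := by
  induction d with
  | zero => simp
  | succ d ih =>
    rw [← add_assoc, Finset.sum_Ioc_succ_top (by omega)]
    have := ih (by omega)
    zify [show c + d + 1 ≤ n by omega] at this ⊢
    linarith

/-- At `c = n/3` the extended rows have total length about `7/18 n^2` and the middle rows about
`3/18 n^2`. -/
theorem EdgeBound.extCost_add_rowCost (h : EdgeBound μ κ n g) {c : ℕ} (hc : 3 * c ≤ n)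
    (hκ : 0 ≤ κ) : MeanAtMost μ κ (fun ω => ((extCost n c (g ω) + rowCost n c (g ω) : ℕ) : ℝ))
      (5 / 9 * n ^ 2 + n) := by
  have h1 := MeanAtMost.sum (s := Finset.range (c + 1)) (fun j hj =>
    h.changes_extRow (show j ≤ n by rw [Finset.mem_range] at hj; omega))
  have h2 := MeanAtMost.sum (s := Finset.Ioc c (c + c)) (fun t ht =>
    h.changes_row (show t ≤ n by rw [Finset.mem_Ioc] at ht; omega))
  rw [← Nat.cast_sum] at h1 h2
  unfold extCost rowCost
  push_cast
  rw [two_mul]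
  refine (h1.add h2).mono hκ ?_
  have k1 := sum_length_extRow n c
  have k2 := sum_length_row n c c (by omega)
  generalize ∑ j ∈ Finset.range (c + 1), (n + j) = A at *
  generalize ∑ t ∈ Finset.Ioc c (c + c), (n - t) = B at *
  rify at k1 k2 hc
  nlinarith [mul_nonneg (sub_nonneg.2 hc) (show (0 : ℝ) ≤ 5 * n - 3 * c by
    have : (0 : ℝ) ≤ n := n.cast_nonneg
    linarith)]

theorem EdgeBound.faceCost (h : EdgeBound μ κ n g) {c : ℕ} (hc : 3 * c ≤ n) (hκ : 0 ≤ κ) :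
    MeanAtMost μ κ (fun ω => (faceCost n c (g ω) : ℝ)) (3 * (5 / 9 * n ^ 2 + n)) := by
  have h1 := h.extCost_add_rowCost hc hκ
  have h2 := h.rot.extCost_add_rowCost hc hκ
  have h3 := h.rot.rot.extCost_add_rowCost hc hκ
  have := (h1.add h2).add h3
  unfold _root_.faceCost
  simp only [Nat.cast_add] at this ⊢
  convert this using 1
  ring

theorem sum_length_cornerPath (m : ℕ) :
    3 * ∑ l ∈ Finset.range m, ∑ _b ∈ Finset.range (l + 1), l + m = m ^ 3 := by
  induction m with
  | zero => simp
  | succ m ih =>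
    rw [Finset.sum_range_succ, Finset.sum_const, Finset.card_range, smul_eq_mul]
    linarith

theorem EdgeBound.vertexCost (h : EdgeBound μ κ n g) {m : ℕ} (hm : m ≤ n) (hκ : 0 ≤ κ) :
    MeanAtMost μ κ (fun ω => (vertexCost n m (g ω) : ℝ)) (m ^ 3 / 3) := by
  have h1 := MeanAtMost.sum (s := Finset.range m) (fun l hl =>
    MeanAtMost.sum (s := Finset.range (l + 1)) (fun b hb =>
      h.changes_cornerPath (show b ≤ l by rw [Finset.mem_range] at hb; omega)
        (show l ≤ n by rw [Finset.mem_range] at hl; omega)))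
  unfold _root_.vertexCost
  push_cast
  refine h1.mono hκ ?_
  have := sum_length_cornerPath m
  rify at this
  have h0 : (0 : ℝ) ≤ m := m.cast_nonneg
  linarith

theorem EdgeBound.cornerCost (h : EdgeBound μ κ n g) {m : ℕ} (hm : 6 * m ≤ n) (hκ : 0 ≤ κ) :
    MeanAtMost μ κ (fun ω => (cornerCost n m (g ω) : ℝ)) (n ^ 3 / 216) := by
  have h1 := h.vertexCost (show m ≤ n by omega) hκ
  have h2 := h.rot.vertexCost (show m ≤ n by omega) hκ
  have h3 := h.rot.rot.vertexCost (show m ≤ n by omega) hκ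
  unfold _root_.cornerCost
  push_cast
  refine ((h1.add h2).add h3).mono hκ ?_
  have h4 := Nat.pow_le_pow_left hm 3
  rify at h4
  linarith

end MeanBound

/-! ### The combined inequality on the tetrahedron. -/

section TetraMean

variable {Ω : Type*} [MeasurableSpace Ω] {μ : Measure Ω} {κ : ℝ} {n : ℕ}
  {f : Ω → (Fin 4 → ℕ) → Fin 5}

/-- Adjacent points of a randomly labelled tetrahedron have different labels with probability at
most `κ`. -/
def TetraEdgeBound (μ : Measure Ω) (κ : ℝ) (n : ℕ) (f : Ω → (Fin 4 → ℕ) → Fin 5) : Prop :=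
  ∀ x y, ∑ i, x i = n → ∑ i, y i = n → ∑ i, ((x i : ℤ) - y i).natAbs ≤ 2 →
    MeanAtMost μ κ (fun ω => if f ω x ≠ f ω y then 1 else 0) 1

theorem TetraEdgeBound.face (h : TetraEdgeBound μ κ n f) (i : Fin 4) :
    EdgeBound μ κ n fun ω => face i (f ω) := by
  intro a b d a' b' d' h1 h2 h3 h4 h5 h6 h7 h8
  refine h _ _ ?_ ?_ ?_
  · rw [sum_insertNth, h1]
  · rw [sum_insertNth, h2]
  · rw [Fin.sum_univ_succAbove _ i]
    simp only [Fin.insertNth_apply_same, Fin.insertNth_apply_succAbove, Fin.sum_univ_three]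
    simp only [Matrix.cons_val]
    omega

theorem TetraEdgeBound.simplexCost {N : ℕ} (h : TetraEdgeBound μ κ (N + 1) f) :
    MeanAtMost μ κ (fun ω => (_root_.simplexCost N (f ω) : ℝ)) (2 * ((N + 1) * (N + 2) * (N + 3))) := by
  have h1 : MeanAtMost μ κ (fun ω => (_root_.simplexCost N (f ω) : ℝ))
      (∑ x ∈ tetraGrid N, ∑ i : Fin 4, ∑ j : Fin 4, if i = j then 0 else 1) := by
    unfold _root_.simplexCost
    push_cast
    refine MeanAtMost.sum fun x hx => MeanAtMost.sum fun i _ => MeanAtMost.sum fun j _ => ?_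
    rw [mem_tetraGrid] at hx
    split_ifs with hij
    · subst hij
      simp [MeanAtMost]
    · refine h _ _ ?_ ?_ ?_
      · rw [sum_add_single, hx]
      · rw [sum_add_single, hx]
      · calc ∑ k, (((x + Pi.single i 1 : Fin 4 → ℕ) k : ℤ) - (x + Pi.single j 1 : Fin 4 → ℕ) k).natAbs
            ≤ ∑ k, ((Pi.single i 1 : Fin 4 → ℕ) k + (Pi.single j 1 : Fin 4 → ℕ) k) := by
              refine Finset.sum_le_sum fun k _ => ?_
              simp only [Pi.add_apply]
              omega
          _ = 2 := by simp [Finset.sum_add_distrib]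
  convert h1 using 1
  have h2 : (∑ i : Fin 4, ∑ j : Fin 4, if i = j then (0 : ℝ) else 1) = 12 := by
    simp [Fin.sum_univ_four]
    norm_num
  rw [Finset.sum_const, h2, nsmul_eq_mul]
  have := six_mul_card_tetraGrid N
  rify at this
  linarith

/-- The cost of a labelling of the tetrahedron. -/
noncomputable def tetraCost (n c m : ℕ) (f : (Fin 4 → ℕ) → Fin 5) : ℝ :=
  ∑ i, (4 * n * (faceCost n c (face i f) : ℝ) + 11 / 96 * n ^ 2 * (sideCost n (face i f) : ℝ)
    + 3 / 4 * (cornerCost n m (face i f) : ℝ)) + 1 / 2 * (simplexCost (n - 1) f : ℝ)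

theorem tetraCost_ge {f : (Fin 4 → ℕ) → Fin 5} {c m : ℕ} (h : TetraLabeling n f) (hn : 100 ≤ n)
    (hc : 3 * c ≤ n) (hc' : n ≤ 3 * c + 2) (hm : 6 * m ≤ n) (hm' : n ≤ 6 * m + 5) :
    279 / 8 * (n : ℝ) ^ 2 - 4168 * n ≤ tetraCost n c m f := by
  -- Take `1/96` of `FaceBound`, `3/4` of the corner estimate and `1/8` of `simplexCost_ge`: the
  -- number of points with the fifth label then has weight `3/4` throughout and cancels. Each face
  -- uses a quarter of the simplex cost weighted by `1/2`.
  have key : ∀ i, 8 * (n : ℝ) ^ 2 + 11 / 32 * n ^ 2 + 3 / 8 * (n * (n + 1)) - 1042 * n ≤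
      4 * n * (faceCost n c (face i f) : ℝ) + 11 / 96 * n ^ 2 * (sideCost n (face i f) : ℝ)
        + 3 / 4 * (cornerCost n m (face i f) : ℝ) + 1 / 8 * (simplexCost (n - 1) f : ℝ) := by
    intro i
    have h1 := faceBound (h.faceLabeling i) hn hc hc' hm hm'
    have h2 := card_innerOthers_zero_le (m := m) (h.faceLabeling i)
    obtain ⟨N, rfl⟩ : ∃ N, n = N + 2 := ⟨n - 2, by omega⟩
    have h3 := simplexCost_ge h i
    rw [show N + 2 - 1 = N + 1 by omega]
    unfold FaceBound at h1
    rify at h2 h3 hn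
    push_cast at h1 ⊢
    nlinarith
  unfold tetraCost
  have := Finset.sum_le_sum fun i (_ : i ∈ (Finset.univ : Finset (Fin 4))) => key i
  rw [Finset.sum_add_distrib (g := fun _ => 1 / 8 * (simplexCost (n - 1) f : ℝ))] at this
  simp only [Finset.sum_const, Finset.card_univ, Fintype.card_fin, nsmul_eq_mul] at this
  push_cast at this
  have hn0 : (0 : ℝ) ≤ n := n.cast_nonneg
  linarith

theorem TetraEdgeBound.tetraCost (h : TetraEdgeBound μ κ n f) {c m : ℕ} (hn : 1 ≤ n)
    (hc : 3 * c ≤ n) (hm : 6 * m ≤ n) (hκ : 0 ≤ κ) :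
    MeanAtMost μ κ (fun ω => tetraCost n c m (f ω))
      (523 / 18 * n ^ 3 + 51 * n ^ 2 + 2 * n) := by
  unfold _root_.tetraCost
  have h1 : ∀ i, MeanAtMost μ κ (fun ω => 4 * n * (_root_.faceCost n c (_root_.face i (f ω)) : ℝ)
      + 11 / 96 * n ^ 2 * (_root_.sideCost n (_root_.face i (f ω)) : ℝ)
        + 3 / 4 * (_root_.cornerCost n m (_root_.face i (f ω)) : ℝ)) _ := fun i =>
    ((((h.face i).faceCost hc hκ).const_mul (r := 4 * n) (by positivity)).add
      ((h.face i).sideCost.const_mul (r := 11 / 96 * n ^ 2) (by positivity))).add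
      (((h.face i).cornerCost hm hκ).const_mul (r := 3 / 4) (by positivity))
  have h2 : TetraEdgeBound μ κ (n - 1 + 1) f := by rwa [Nat.sub_add_cancel hn]
  refine ((MeanAtMost.sum (s := Finset.univ) fun i _ => h1 i).add
    (h2.simplexCost.const_mul (r := 1 / 2) (by norm_num))).mono hκ ?_
  rw [Finset.sum_const, Finset.card_univ, Fintype.card_fin, nsmul_eq_mul]
  push_cast [hn]
  ring_nf
  have : (0 : ℝ) ≤ n := n.cast_nonneg
  nlinarith [pow_nonneg this 3]

theorem TetraEdgeBound.bound [IsProbabilityMeasure μ] (h : TetraEdgeBound μ κ n f)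
    (hf : ∀ ω, TetraLabeling n (f ω)) (hn : 100 ≤ n) (hκ : 0 ≤ κ) :
    279 / 8 * (n : ℝ) ^ 2 - 4168 * n ≤ (523 / 18 * n ^ 3 + 51 * n ^ 2 + 2 * n) * κ := by
  have h1 := h.tetraCost (c := n / 3) (m := n / 6) (by omega) (by omega) (by omega) hκ
  refine le_trans ?_ h1.2
  have h2 := integral_mono (μ := μ) (integrable_const _) h1.1 fun ω =>
    tetraCost_ge (c := n / 3) (m := n / 6) (hf ω) hn (by omega) (by omega) (by omega) (by omega)
  simpa using h2

end TetraMean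

/-! ### Separation probabilities and the maximum density. -/

section Density

variable {k n : ℕ}

theorem halfL1Dist_self (x : Simplex k) : halfL1Dist x x = 0 := by simp [halfL1Dist]

theorem halfL1Dist_nonneg (x y : Simplex k) : 0 ≤ halfL1Dist x y :=
  mul_nonneg (by norm_num) (Finset.sum_nonneg fun _ _ => abs_nonneg _)

theorem halfL1Dist_pos {x y : Simplex k} (h : x ≠ y) : 0 < halfL1Dist x y := by
  refine mul_pos (by norm_num) ?_
  obtain ⟨i, hi⟩ : ∃ i, x.1 i ≠ y.1 i := by
    by_contra hc
    push Not at hc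
    exact h (Subtype.ext (funext hc))
  exact Finset.sum_pos' (fun _ _ => abs_nonneg _)
    ⟨i, Finset.mem_univ i, abs_pos.2 (sub_ne_zero.2 hi)⟩

theorem discreteSimplex_finite (k : ℕ) (hn : 1 ≤ n) : (discreteSimplex k n).Finite := by
  have hn0 : (0 : ℝ) < n := by exact_mod_cast hn
  have h : Set.Finite {x : Fin k → ℝ | ∀ i, x i ∈ (fun z : ℤ => (1 / (n : ℝ)) * z) '' Set.Icc 0 n} :=
    Set.Finite.pi' fun _ => (Set.finite_Icc _ _).image _
  refine (h.preimage (f := Subtype.val) Subtype.val_injective.injOn).subset fun x hx i => ?_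
  obtain ⟨z, hz⟩ := hx i
  have h0 : 0 ≤ x.1 i := x.2.1 i
  have h1 : x.1 i ≤ 1 := by
    rw [← x.2.2]
    exact Finset.single_le_sum (fun j _ => x.2.1 j) (Finset.mem_univ i)
  refine ⟨z, ⟨?_, ?_⟩, hz.symm⟩
  · rw [hz] at h0
    have := (mul_nonneg_iff_of_pos_left (by positivity)).1 h0
    exact_mod_cast this
  · rw [hz, one_div, inv_mul_le_iff₀ hn0, mul_one] at h1
    exact_mod_cast h1

theorem densities_finite (hn : 1 ≤ n) (φ : Simplex k → Simplex k → ℝ) :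
    {d : ℝ | ∃ x ∈ discreteSimplex k n, ∃ y ∈ discreteSimplex k n, x ≠ y ∧ d = φ x y}.Finite := by
  refine (((discreteSimplex_finite k hn).prod (discreteSimplex_finite k hn)).image
    fun p => φ p.1 p.2).subset ?_
  rintro d ⟨x, hx, y, hy, -, rfl⟩
  exact ⟨(x, y), ⟨hx, hy⟩, rfl⟩

theorem maxDensity_nonneg (k n : ℕ) (μ : Measure (Cut k)) : 0 ≤ maxDensity k n μ := by
  refine Real.sSup_nonneg ?_
  rintro d ⟨x, -, y, -, -, rfl⟩
  exact div_nonneg measureReal_nonneg (halfL1Dist_nonneg x y)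

theorem measureReal_ne_le (hn : 1 ≤ n) (μ : Measure (Cut k)) {x y : Simplex k}
    (hx : x ∈ discreteSimplex k n) (hy : y ∈ discreteSimplex k n) :
    μ.real {P | P.1 x ≠ P.1 y} ≤ maxDensity k n μ * halfL1Dist x y := by
  by_cases h : x = y
  · subst h
    simp [halfL1Dist_self]
  · rw [← div_le_iff₀ (halfL1Dist_pos h)]
    exact le_csSup (densities_finite hn
      fun x y => μ.real {P | P.1 x ≠ P.1 y} / halfL1Dist x y).bddAbove ⟨x, hx, y, hy, h, rfl⟩

theorem measurable_nonOppositeCut_apply (x : Simplex k) :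
    Measurable fun P : NonOppositeCut k => P.1.1 x :=
  (measurable_pi_apply x).comp (measurable_subtype_coe.comp measurable_subtype_coe)

theorem measurableSet_ne (x y : Simplex k) : MeasurableSet {P : NonOppositeCut k | P.1.1 x ≠ P.1.1 y} :=
  (measurableSet_eq_fun (measurable_nonOppositeCut_apply x)
    (measurable_nonOppositeCut_apply y)).compl

theorem measurableSet_cut_ne (x y : Simplex k) : MeasurableSet {P : Cut k | P.1 x ≠ P.1 y} :=
  (measurableSet_eq_fun ((measurable_pi_apply x).comp measurable_subtype_coe)
    ((measurable_pi_apply y).comp measurable_subtype_coe)).compl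

theorem map_measureReal_ne (ν : Measure (NonOppositeCut k)) (x y : Simplex k) :
    (ν.map Subtype.val).real {P | P.1 x ≠ P.1 y} = ν.real {P | P.1.1 x ≠ P.1.1 y} :=
  map_measureReal_apply measurable_subtype_coe (measurableSet_cut_ne x y)

end Density

/-! ### From cuts to grid labellings, and the numerical bound. -/

section GridPoint

variable {n : ℕ}

open Classical in
/-- The point `x / n` of the simplex, where the coordinates of `x` have sum `n`. -/
noncomputable def gridPoint (n : ℕ) (x : Fin 4 → ℕ) : Simplex 4 :=
  if h : 1 ≤ n ∧ ∑ i, x i = n then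
    ⟨fun i => x i / n, fun i => by positivity, by
      rw [← Finset.sum_div, ← Nat.cast_sum, h.2]
      exact div_self (by have := h.1; positivity)⟩
  else Classical.arbitrary _

theorem gridPoint_apply {x : Fin 4 → ℕ} (hn : 1 ≤ n) (hx : ∑ i, x i = n) (i : Fin 4) :
    (gridPoint n x).1 i = x i / n := by
  unfold gridPoint
  rw [dif_pos ⟨hn, hx⟩]

theorem gridPoint_mem {x : Fin 4 → ℕ} (hn : 1 ≤ n) (hx : ∑ i, x i = n) :
    gridPoint n x ∈ discreteSimplex 4 n := by
  intro i
  refine ⟨x i, ?_⟩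
  rw [gridPoint_apply hn hx]
  push_cast
  ring

theorem halfL1Dist_gridPoint_le {x y : Fin 4 → ℕ} (hn : 1 ≤ n) (hx : ∑ i, x i = n)
    (hy : ∑ i, y i = n) (hxy : ∑ i, ((x i : ℤ) - y i).natAbs ≤ 2) :
    halfL1Dist (gridPoint n x) (gridPoint n y) ≤ 1 / n := by
  have hn0 : (0 : ℝ) < n := by exact_mod_cast hn
  have h : ∑ i, |(gridPoint n x).1 i - (gridPoint n y).1 i| =
      ((∑ i, ((x i : ℤ) - y i).natAbs : ℕ) : ℝ) / n := by
    push_cast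
    rw [Finset.sum_div]
    refine Finset.sum_congr rfl fun i _ => ?_
    rw [gridPoint_apply hn hx, gridPoint_apply hn hy, ← sub_div, abs_div, abs_of_pos hn0,
      Nat.cast_natAbs]
    push_cast
    rfl
  unfold halfL1Dist
  rw [h]
  have h2 : ((∑ i, ((x i : ℤ) - y i).natAbs : ℕ) : ℝ) ≤ 2 := by exact_mod_cast hxy
  rw [mul_div_assoc', div_le_div_iff_of_pos_right hn0]
  linarith

theorem tetraLabeling_gridPoint (hn : 1 ≤ n) (P : NonOppositeCut 4) :
    TetraLabeling n fun x => P.1.1 (gridPoint n x) where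
  vertex i := by
    refine P.1.2 _ _ ?_
    ext j
    rw [gridPoint_apply hn (by simp)]
    by_cases hj : j = i
    · subst hj
      simp only [Pi.single_eq_same]
      exact div_self (by positivity)
    · simp [Pi.single_eq_of_ne hj]
  support x i hx hP := by
    rcases P.2 (gridPoint n x) with ⟨j, hj, e⟩ | e
    · rw [hP] at e
      obtain rfl := Fin.castSucc_injective _ e
      rw [gridPoint_apply hn hx] at hj
      intro h0
      simp [h0] at hj
    · rw [hP] at e
      exact absurd e (Fin.castSucc_lt_last i).ne

theorem tetraEdgeBound_gridPoint (hn : 1 ≤ n) (ν : Measure (NonOppositeCut 4))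
    [IsProbabilityMeasure ν] :
    TetraEdgeBound ν (maxDensity 4 n (ν.map Subtype.val) / n) n
      fun P x => P.1.1 (gridPoint n x) := by
  intro x y hx hy hxy
  have hS := measurableSet_ne (gridPoint n x) (gridPoint n y)
  have hF : (fun P : NonOppositeCut 4 =>
      if P.1.1 (gridPoint n x) ≠ P.1.1 (gridPoint n y) then (1 : ℝ) else 0) =
      {P : NonOppositeCut 4 | P.1.1 (gridPoint n x) ≠ P.1.1 (gridPoint n y)}.indicator 1 := by
    ext P
    simp [Set.indicator_apply]
  rw [hF]
  refine ⟨(integrable_const 1).indicator hS, ?_⟩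
  rw [integral_indicator_one hS, one_mul, ← map_measureReal_ne]
  refine (measureReal_ne_le hn _ (gridPoint_mem hn hx) (gridPoint_mem hn hy)).trans ?_
  rw [div_eq_mul_one_div]
  exact mul_le_mul_of_nonneg_left (halfL1Dist_gridPoint_le hn hx hy hxy) (maxDensity_nonneg _ _ _)

theorem maxDensity_ge (hn : 1 ≤ n) (ν : Measure (NonOppositeCut 4)) [IsProbabilityMeasure ν] :
    1.20016 - 1000 / (n : ℝ) ≤ maxDensity 4 n (ν.map Subtype.val) := by
  have h0 := maxDensity_nonneg 4 n (ν.map Subtype.val)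
  have hn0 : (0 : ℝ) < n := by exact_mod_cast hn
  -- For `n < 100` the term `1000 / n` exceeds `10` and the bound is vacuous. From `100` on, it
  -- absorbs the linear error `4168 n` and the lower-order path lengths.
  rcases lt_or_ge n 100 with hlt | hge
  · have h1 : (n : ℝ) < 100 := by exact_mod_cast hlt
    have : 1.20016 ≤ 1000 / (n : ℝ) := by
      rw [le_div_iff₀ hn0]
      linarith
    linarith
  · have h1 := (tetraEdgeBound_gridPoint hn ν).bound (tetraLabeling_gridPoint hn) hge
      (div_nonneg h0 hn0.le)
    generalize maxDensity 4 n (ν.map Subtype.val) = τ at *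
    have hge' : (100 : ℝ) ≤ n := by exact_mod_cast hge
    have h2 : (523 / 18 * (n : ℝ) ^ 3 + 51 * n ^ 2 + 2 * n) * (τ / n) =
        (523 / 18 * (n : ℝ) ^ 2 + 51 * n + 2) * τ := by
      field_simp
    rw [h2] at h1
    rw [sub_le_iff_le_add]
    by_contra hc
    push Not at hc
    have h3 : τ * n + 1000 < 1.20016 * n := by
      have := mul_lt_mul_of_pos_right hc hn0
      rwa [add_mul, div_mul_cancel₀ _ hn0.ne'] at this
    have h4 : τ ≤ 1.20016 := by nlinarith
    nlinarith

end GridPoint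

/-! ### Existence of an optimal distribution. -/

section Attainment

variable {k n : ℕ}

theorem nonempty_nonOppositeCut (k : ℕ) : Nonempty (NonOppositeCut k) := by
  classical
  refine ⟨⟨⟨fun x => if h : ∃ i, x.1 = Pi.single i 1 then h.choose.castSucc else Fin.last k, ?_⟩,
    ?_⟩⟩
  · intro x i hx
    have h : ∃ i, x.1 = Pi.single i 1 := ⟨i, hx⟩
    dsimp only
    rw [dif_pos h]
    have h1 := h.choose_spec
    congr 1
    by_contra hne
    have h2 : (Pi.single h.choose 1 : Fin k → ℝ) i = 1 := by
      rw [← h1, hx, Pi.single_eq_same]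
    rw [Pi.single_eq_of_ne (Ne.symm hne)] at h2
    exact zero_ne_one h2
  · intro x
    dsimp only
    split_ifs with h
    · refine Or.inl ⟨h.choose, ?_, rfl⟩
      have := congrFun h.choose_spec h.choose
      rw [Pi.single_eq_same] at this
      rw [this]
      exact one_ne_zero
    · exact Or.inr rfl

/-- The restriction of a cut to the discretized simplex. -/
def gridRestriction (k n : ℕ) (P : NonOppositeCut k) (x : discreteSimplex k n) : Fin (k + 1) :=
  P.1.1 x

theorem measurable_gridRestriction (k n : ℕ) : Measurable (gridRestriction k n) :=
  measurable_pi_lambda _ fun x => measurable_nonOppositeCut_apply x.1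

/-- The restrictions of non-opposite cuts to the discretized simplex. -/
abbrev GridCut (k n : ℕ) : Type := Set.range (gridRestriction k n)

open Classical in
/-- The probability that a random grid cut with distribution `w` separates two points. -/
noncomputable def separation [Fintype (GridCut k n)] (w : GridCut k n → ℝ)
    (x y : discreteSimplex k n) : ℝ :=
  ∑ t : GridCut k n, if t.1 x ≠ t.1 y then w t else 0

/-- Extend each grid cut to one non-opposite cut and mix the Dirac measures; with
`exists_weights_of_measure` this reduces the minimization to a finite-dimensional simplex. -/
theorem exists_measure_of_weights [Fintype (GridCut k n)] {w : GridCut k n → ℝ}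
    (hw : w ∈ stdSimplex ℝ (GridCut k n)) :
    ∃ ν : Measure (NonOppositeCut k), IsProbabilityMeasure ν ∧
      ∀ x y : discreteSimplex k n, ν.real {P | P.1.1 x ≠ P.1.1 y} = separation w x y := by
  classical
  choose s hs using fun t : GridCut k n => t.2
  refine ⟨∑ t, ENNReal.ofReal (w t) • Measure.dirac (s t), ⟨?_⟩, fun x y => ?_⟩
  · rw [Measure.finsetSum_apply]
    simp only [Measure.smul_apply, measure_univ, smul_eq_mul, mul_one]
    rw [← ENNReal.ofReal_sum_of_nonneg fun t _ => hw.1 t, hw.2, ENNReal.ofReal_one]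
  · rw [measureReal_def, Measure.finsetSum_apply, ENNReal.toReal_sum]
    · refine Finset.sum_congr rfl fun t _ => ?_
      rw [Measure.smul_apply, Measure.dirac_apply' _ (measurableSet_ne x.1 y.1), Set.indicator_apply,
        ← hs t]
      unfold gridRestriction
      simp only [Set.mem_ofPred_eq]
      split_ifs <;> simp [ENNReal.toReal_ofReal (hw.1 t)]
    · intro t _
      rw [Measure.smul_apply]
      exact ENNReal.mul_ne_top ENNReal.ofReal_ne_top (measure_ne_top _ _)

theorem exists_weights_of_measure [Fintype (GridCut k n)] [Finite (discreteSimplex k n)]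
    (ν : Measure (NonOppositeCut k)) [IsProbabilityMeasure ν] :
    ∃ w ∈ stdSimplex ℝ (GridCut k n),
      ∀ x y : discreteSimplex k n, ν.real {P | P.1.1 x ≠ P.1.1 y} = separation w x y := by
  classical
  have hm : ∀ t : GridCut k n,
      MeasurableSet (Set.rangeFactorization (gridRestriction k n) ⁻¹' {t}) := by
    intro t
    have : Set.rangeFactorization (gridRestriction k n) ⁻¹' {t} = gridRestriction k n ⁻¹' {t.1} := by
      ext P
      simp [Set.rangeFactorization, Subtype.ext_iff]
    rw [this]
    exact measurable_gridRestriction k n (measurableSet_singleton _)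
  refine ⟨fun t => ν.real (Set.rangeFactorization (gridRestriction k n) ⁻¹' {t}),
    ⟨fun t => measureReal_nonneg, ?_⟩, fun x y => ?_⟩
  · rw [sum_measureReal_preimage_singleton _ fun t _ => hm t]
    simp
  · unfold separation
    rw [← Finset.sum_filter, sum_measureReal_preimage_singleton _ fun t _ => hm t]
    congr 1
    ext P
    simp [Set.rangeFactorization, gridRestriction]

theorem maxDensity_eq_iSup (ν : Measure (NonOppositeCut k)) :
    maxDensity k n (ν.map Subtype.val) =
      ⨆ p : {p : discreteSimplex k n × discreteSimplex k n // p.1 ≠ p.2},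
        ν.real {P | P.1.1 p.1.1 ≠ P.1.1 p.1.2} / halfL1Dist p.1.1.1 p.1.2.1 := by
  unfold maxDensity iSup
  congr 1
  ext d
  simp only [map_measureReal_ne]
  constructor
  · rintro ⟨x, hx, y, hy, hxy, rfl⟩
    exact ⟨⟨(⟨x, hx⟩, ⟨y, hy⟩), fun e => hxy (congrArg Subtype.val e)⟩, rfl⟩
  · rintro ⟨⟨⟨x, y⟩, hxy⟩, rfl⟩
    exact ⟨x, x.2, y, y.2, fun e => hxy (Subtype.ext e), rfl⟩

/-- The minimum of the maximum density is attained. -/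
theorem exists_isLeast_nonOppositeDensities (k : ℕ) (hn : 1 ≤ n) :
    ∃ t, IsLeast (nonOppositeDensities k n) t := by
  have hfin : Finite (discreteSimplex k n) := discreteSimplex_finite k hn
  have : Fintype (GridCut k n) := Fintype.ofFinite _
  classical
  let Φ : (GridCut k n → ℝ) → ℝ := fun w =>
    ⨆ p : {p : discreteSimplex k n × discreteSimplex k n // p.1 ≠ p.2},
      separation w p.1.1 p.1.2 / halfL1Dist p.1.1.1 p.1.2.1
  -- `Φ` is a finite supremum of functions linear in the weights; lower semicontinuity suffices for
  -- a minimum on a compact set.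
  have hΦ : LowerSemicontinuous Φ := by
    refine lowerSemicontinuous_ciSup (fun w => (Set.finite_range _).bddAbove) fun p => ?_
    refine Continuous.lowerSemicontinuous (Continuous.div_const ?_ _)
    unfold separation
    refine continuous_finsetSum _ fun t _ => ?_
    split_ifs
    · exact continuous_apply t
    · exact continuous_const
  obtain ⟨P⟩ := nonempty_nonOppositeCut k
  obtain ⟨w, hw, hmin⟩ := (hΦ.lowerSemicontinuousOn _).exists_isMinOn
    (⟨_, single_mem_stdSimplex ℝ (⟨_, P, rfl⟩ : GridCut k n)⟩ : (stdSimplex ℝ (GridCut k n)).Nonempty)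
    (isCompact_stdSimplex ℝ (GridCut k n))
  refine ⟨Φ w, ?_, ?_⟩
  · obtain ⟨ν, hν, h⟩ := exists_measure_of_weights hw
    refine ⟨ν, hν, ?_⟩
    rw [maxDensity_eq_iSup]
    simp only [h, Φ]
  · rintro t ⟨ν, hν, rfl⟩
    obtain ⟨w', hw', h⟩ := exists_weights_of_measure (n := n) ν
    rw [maxDensity_eq_iSup]
    simp only [h]
    exact hmin hw'

end Attainment

theorem theorem2 :
    ∃ C : ℝ, ∀ n : ℕ, 1 ≤ n →
      IsLeast (nonOppositeDensities 4 n) (minMaxDensity 4 n) ∧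
        minMaxDensity 4 n ≥ 1.20016 - C / (n : ℝ) := by
  refine ⟨1000, fun n hn => ?_⟩
  obtain ⟨t, ht⟩ := exists_isLeast_nonOppositeDensities 4 hn
  have h : minMaxDensity 4 n = t := ht.csInf_eq
  rw [h]
  refine ⟨ht, ?_⟩
  obtain ⟨ν, hν, rfl⟩ := ht.1
  exact maxDensity_ge hn ν
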